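/- Let $N\ge 2$, let $\Omega\subset\mathbb R^N$ be a bounded open set with Lipschitz boundary (not necessarily connected), and let $0<s<1<p<N$. Let $q\in\left(\frac{N}{sp},\infty\right)$ and $V,g\in L^q(\Omega)$ with $V\ge 0$ and $g>0$ a.e. in $\Omega$. Let $$X_0^{s,p}(\Omega)=\{u\in W^{1,p}(\mathbb R^N):\ u|_\Omega\in W^{1,p}_0(\Omega),\ u=0 \text{ a.e. in } \mathbb R^N\setminus\Omega\},$$ where $W_0^{1,p}(\Omega)$ is the closure of $C_c^\infty(\Omega)$ in $W^{1,p}(\Omega)$. A function $u\in X_0^{s,p}(\Omega)$ that is not a.e. equal to $0$ is called an eigenfunction with eigenvalue $\lambda\in\mathbb R$ of $$-\Delta_p u+(-\Delta_p)^s u+V|u|^{p-2}u=\lambda g|u|^{p-2}u \ \text{ in }\Omega,\qquad u=0\ \text{ in }\mathbb R^N\setminus\Omega,$$ if for all $v\in X_0^{s,p}(\Omega)$ $$\int_\Omega|\nabla u|^{p-2}\nabla u\cdot\nabla v\,dx+\int_{\mathbb R^N}\int_{\mathbb R^N}\frac{|u(x)-u(y)|^{p-2}(u(x)-u(y))(v(x)-v(y))}{|x-y|^{N+sp}}\,dx\,dy+\int_\Omega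 V|u|^{p-2}uv\,dx-\lambda\int_\Omega g|u|^{p-2}uv\,dx=0.$$ If $u$ is an eigenfunction with an eigenvalue $\lambda>0$ and $u\ge 0$ a.e. in $\Omega$, then $u>0$ a.e. in $\Omega$. -/

import Mathlib

open MeasureTheory Filter Topology Set
open scoped ContDiff

noncomputable section

namespace MixedEigen

/-- The space `ℝ^N` with its Euclidean norm and Lebesgue measure. -/
abbrev Sp (N : ℕ) : Type := EuclideanSpace ℝ (Fin N)

/-- `Ω` has Lipschitz boundary: near each boundary point, in a suitable orthonormal coordinate
system with last axis `e`, the set `Ω` is the region strictly above the graph of a Lipschitz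
function of the remaining coordinates (`y - ⟪e, y⟫ e` is the projection of `y` to the hyperplane
orthogonal to `e`). -/
def HasLipschitzBoundary {N : ℕ} (Ω : Set (Sp N)) : Prop :=
  ∀ x ∈ frontier Ω, ∃ e : Sp N, ‖e‖ = 1 ∧ ∃ (K : NNReal) (γ : Sp N → ℝ), LipschitzWith K γ ∧
    ∃ r > 0, ∀ y ∈ Metric.ball x r,
      (y ∈ Ω ↔ γ (y - (inner ℝ e y) • e) < inner ℝ e y)

/-- Test functions: `φ ∈ C_c^∞(Ω)`. -/
def IsTestFunction {N : ℕ} (Ω : Set (Sp N)) (φ : Sp N → ℝ) : Prop :=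
  ContDiff ℝ ∞ φ ∧ HasCompactSupport φ ∧ tsupport φ ⊆ Ω

/-- `G` is a weak (distributional) gradient of `u` in the open set `Ω`. -/
def HasWeakGradient {N : ℕ} (Ω : Set (Sp N)) (u : Sp N → ℝ) (G : Sp N → Sp N) : Prop :=
  LocallyIntegrableOn u Ω ∧ LocallyIntegrableOn G Ω ∧
    ∀ φ : Sp N → ℝ, IsTestFunction Ω φ → ∀ i : Fin N,
      ∫ x in Ω, u x * fderiv ℝ φ x (EuclideanSpace.single i 1) = - ∫ x in Ω, G x i * φ x

open Classical in
/-- The weak gradient `∇u` of `u` in `Ω` (a representative; it is unique up to null sets in `Ω`),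
and `0` if there is none. -/
def weakGrad {N : ℕ} (Ω : Set (Sp N)) (u : Sp N → ℝ) : Sp N → Sp N :=
  if h : ∃ G, HasWeakGradient Ω u G then h.choose else 0

/-- `u ∈ W^{1,p}(Ω)`. -/
def MemW1p {N : ℕ} (p : ℝ) (Ω : Set (Sp N)) (u : Sp N → ℝ) : Prop :=
  MemLp u (ENNReal.ofReal p) (volume.restrict Ω) ∧
    ∃ G, HasWeakGradient Ω u G ∧ MemLp G (ENNReal.ofReal p) (volume.restrict Ω)

/-- `u ∈ W_0^{1,p}(Ω)`, the closure of `C_c^∞(Ω)` in `W^{1,p}(Ω)`. -/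
def MemW01p {N : ℕ} (p : ℝ) (Ω : Set (Sp N)) (u : Sp N → ℝ) : Prop :=
  MemW1p p Ω u ∧ ∃ φ : ℕ → Sp N → ℝ, (∀ n, IsTestFunction Ω (φ n)) ∧
    Tendsto (fun n => eLpNorm (fun x => u x - φ n x) (ENNReal.ofReal p) (volume.restrict Ω))
      atTop (𝓝 0) ∧
    Tendsto (fun n => eLpNorm (fun x => weakGrad Ω u x - gradient (φ n) x)
      (ENNReal.ofReal p) (volume.restrict Ω)) atTop (𝓝 0)

/-- `u ∈ X_0^{s,p}(Ω)`: `u ∈ W^{1,p}(ℝ^N)`, `u|_Ω ∈ W_0^{1,p}(Ω)`, and `u = 0` (almost everywhere)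
in `ℝ^N \ Ω`. As a set of functions the space does not depend on `s`. -/
def MemX {N : ℕ} (p : ℝ) (Ω : Set (Sp N)) (u : Sp N → ℝ) : Prop :=
  MemW1p p univ u ∧ MemW01p p Ω u ∧ ∀ᵐ x, x ∉ Ω → u x = 0

/-- The form `H_{s,p}(u,v)` of the mixed operator `-Δ_p + (-Δ_p)^s`. -/
def H {N : ℕ} (s p : ℝ) (Ω : Set (Sp N)) (u v : Sp N → ℝ) : ℝ :=
  (∫ x in Ω, ‖weakGrad Ω u x‖ ^ (p - 2) * inner ℝ (weakGrad Ω u x) (weakGrad Ω v x)) +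
    ∫ x, ∫ y, |u x - u y| ^ (p - 2) * (u x - u y) * (v x - v y) / ‖x - y‖ ^ ((N : ℝ) + s * p)

/-- `u` is a weak solution of `-Δ_p u + (-Δ_p)^s u + V |u|^{p-2} u = λ g |u|^{p-2} u` in `Ω`,
`u = 0` in `ℝ^N \ Ω`. -/
def IsWeakSolution {N : ℕ} (s p : ℝ) (Ω : Set (Sp N)) (V g : Sp N → ℝ) (lam : ℝ)
    (u : Sp N → ℝ) : Prop :=
  MemX p Ω u ∧ ∀ v, MemX p Ω v →
    H s p Ω u v + (∫ x in Ω, V x * |u x| ^ (p - 2) * u x * v x)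
      - lam * (∫ x in Ω, g x * |u x| ^ (p - 2) * u x * v x) = 0

/-- `u` is an eigenfunction for the eigenvalue `lam`: a weak solution that is not zero (as an
element of the function space, i.e. not almost everywhere zero). -/
def IsEigenfunction {N : ℕ} (s p : ℝ) (Ω : Set (Sp N)) (V g : Sp N → ℝ) (lam : ℝ)
    (u : Sp N → ℝ) : Prop :=
  IsWeakSolution s p Ω V g lam u ∧ ¬ (∀ᵐ x, u x = 0)

end MixedEigen

end

/-! Suppose `u` vanishes on a subset of `Ω` of positive measure. Choose a point of it all of whose
neighbourhoods meet it in positive measure, and a test function ψ ≥ 0 that is positive near that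
point. The equation is tested with vₙ = ψ kₙ(u), where kₙ(t) = exp(-((n+1)t)²), so that vₙ tends to
ψ times the indicator of {u = 0}.

Since kₙ is nonincreasing on [0, ∞), the local part is at most ∫ kₙ(u) |∇u|^(p-2) ∇u·∇ψ. This tends
to 0 because ∇u = 0 a.e. on {u = 0} (`MemX.weakGrad_eq_zero`). The potential term tends to 0 as
well, and the term with λ g has a favourable sign and is discarded. In the nonlocal part, pairs with
u(x) = 0 < u(y) leave a strictly negative contribution that survives the limit:
`nonlocal_pointwise_le` bounds this part by o(1) - δ with δ > 0 fixed. The equation then gives δ ≤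
o(1), a contradiction. A zero of `u` interacts directly with every point where u > 0, whichever
component of `Ω` contains it.

Two technical facts support this. The vₙ are admissible, with the expected product and chain rule
(`memX_mul_comp`). The double integrals converge absolutely, because W^{1,p} controls the Gagliardo
seminorm for s < 1 (`MemX.integrable_gagliardo`). -/

namespace MixedEigen

variable {N : ℕ}

/-! ### Convergence in L^p -/

section LpConvergence

variable {α : Type*} [MeasurableSpace α] {μ : Measure α}

/-- The pairing of an `L^p`-convergent sequence with a function in the dual space converges. -/
lemma tendsto_integral_mul_of_tendsto_eLpNorm {p p' : ENNReal} [p.HolderConjugate p']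
    {f : ℕ → α → ℝ} {v ξ : α → ℝ} (hv : MemLp v p μ) (hf : ∀ n, MemLp (f n) p μ)
    (hξ : MemLp ξ p' μ) (h : Tendsto (fun n => eLpNorm (fun x => v x - f n x) p μ) atTop (𝓝 0)) :
    Tendsto (fun n => ∫ x, f n x * ξ x ∂μ) atTop (𝓝 (∫ x, v x * ξ x ∂μ)) := by
  refine tendsto_integral_of_L1' _ (hv.integrable_mul hξ).aestronglyMeasurable
    (Eventually.of_forall fun n => (hf n).integrable_mul hξ) ?_
  refine tendsto_of_tendsto_of_tendsto_of_le_of_le tendsto_const_nhds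
    (h := fun n => eLpNorm (fun x => v x - f n x) p μ * eLpNorm ξ p' μ) ?_
    (fun n => zero_le) fun n => ?_
  · simpa using ENNReal.Tendsto.mul_const h (Or.inr hξ.eLpNorm_ne_top)
  · refine le_trans (eLpNorm_mono_enorm (g := (fun x => v x - f n x) • ξ) fun x => ?_)
      (eLpNorm_smul_le_mul_eLpNorm (p := p) (q := p') (r := 1) hξ.1 (hv.sub (hf n)).1)
    simp only [Pi.sub_apply, Pi.mul_apply, Pi.smul_apply', smul_eq_mul]
    rw [← sub_mul, enorm_mul, enorm_mul, enorm_sub_rev]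

/-- Dominated convergence in `L^p`. -/
lemma tendsto_eLpNorm_of_dominated {E : Type*} [NormedAddCommGroup E] {p : ENNReal} (hp0 : p ≠ 0)
    (hp : p ≠ ⊤) {f : ℕ → α → E} {b : α → ℝ} (hf : ∀ n, AEStronglyMeasurable (f n) μ)
    (hb : MemLp b p μ) (hfb : ∀ n, ∀ᵐ x ∂μ, ‖f n x‖ ≤ b x)
    (h : ∀ᵐ x ∂μ, Tendsto (fun n => f n x) atTop (𝓝 0)) :
    Tendsto (fun n => eLpNorm (f n) p μ) atTop (𝓝 0) := by
  have hpp : 0 < p.toReal := ENNReal.toReal_pos hp0 hp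
  simp_rw [eLpNorm_eq_lintegral_rpow_enorm_toReal hp0 hp]
  have key : Tendsto (fun n => ∫⁻ x, ‖f n x‖ₑ ^ p.toReal ∂μ) atTop (𝓝 (∫⁻ _, 0 ∂μ)) := by
    refine tendsto_lintegral_of_dominated_convergence' (fun x => ‖b x‖ₑ ^ p.toReal)
      (fun n => (hf n).enorm.pow_const _) (fun n => ?_) ?_ ?_
    · filter_upwards [hfb n] with x hx
      gcongr
      rw [← enorm_norm (f n x)]
      exact enorm_le_iff_norm_le.2 (by simpa using hx.trans (le_abs_self _))
    · exact (lintegral_rpow_enorm_lt_top_of_eLpNorm_lt_top hp0 hp hb.2).ne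
    · filter_upwards [h] with x hx
      have := (ENNReal.continuous_rpow_const (y := p.toReal)).tendsto 0
      rw [ENNReal.zero_rpow_of_pos hpp] at this
      refine this.comp ?_
      simpa using hx.enorm
  have := (ENNReal.continuous_rpow_const (y := 1 / p.toReal)).tendsto 0
  rw [ENNReal.zero_rpow_of_pos (by positivity)] at this
  rw [lintegral_zero] at key
  exact this.comp key

end LpConvergence

/-! ### Weak gradients and test functions -/

lemma HasWeakGradient.weakGrad {Ω : Set (Sp N)} {u : Sp N → ℝ} {G : Sp N → Sp N}
    (h : HasWeakGradient Ω u G) : HasWeakGradient Ω u (weakGrad Ω u) := by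
  have h' : ∃ G, HasWeakGradient Ω u G := ⟨G, h⟩
  rw [MixedEigen.weakGrad, dif_pos h']
  exact h'.choose_spec

/-- Weak gradients are unique up to null sets. -/
lemma HasWeakGradient.ae_eq {Ω : Set (Sp N)} (hΩ : IsOpen Ω) {u : Sp N → ℝ} {G G' : Sp N → Sp N}
    (h : HasWeakGradient Ω u G) (h' : HasWeakGradient Ω u G') :
    G =ᵐ[volume.restrict Ω] G' := by
  have key : ∀ i : Fin N, ∀ᵐ x, x ∈ Ω → G x i - G' x i = 0 := by
    intro i
    have hl : ∀ {F : Sp N → Sp N}, LocallyIntegrableOn F Ω →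
        LocallyIntegrableOn (fun x => F x i) Ω := by
      intro F hF x hx
      obtain ⟨s, hs, hi⟩ := hF x hx
      exact ⟨s, hs, (EuclideanSpace.proj (𝕜 := ℝ) i).integrable_comp hi⟩
    -- Fundamental lemma of the calculus of variations, one coordinate at a time.
    refine hΩ.ae_eq_zero_of_integral_contDiff_smul_eq_zero ((hl h.2.1).sub (hl h'.2.1)) ?_
    intro φ hφ hφc hφs
    have e1 := h.2.2 φ ⟨hφ, hφc, hφs⟩ i
    have e2 := h'.2.2 φ ⟨hφ, hφc, hφs⟩ i
    have hi : ∀ {F : Sp N → Sp N}, LocallyIntegrableOn F Ω →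
        Integrable (fun x => F x i * φ x) := by
      intro F hF
      have := ((hl hF).integrableOn_compact_subset hφs hφc)
      have h2 : IntegrableOn (fun x => F x i * φ x) (tsupport φ) :=
        this.mul_continuousOn hφ.continuous.continuousOn hφc
      refine (integrableOn_iff_integrable_of_support_subset ?_).1 h2
      intro x hx
      refine subset_tsupport _ ?_
      rw [Function.mem_support] at hx ⊢
      exact fun h0 => hx (by simp [h0])
    have hz : ∀ {F : Sp N → Sp N}, ∫ x in Ω, F x i * φ x = ∫ x, F x i * φ x := by
      intro F
      refine setIntegral_eq_integral_of_forall_compl_eq_zero fun x hx => ?_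
      rw [image_eq_zero_of_notMem_tsupport fun hx' => hx (hφs hx'), mul_zero]
    rw [hz] at e1 e2
    have : ∫ x, φ x • (G x i - G' x i) = ∫ x, (G x i * φ x - G' x i * φ x) := by
      congr 1; ext x; simp only [smul_eq_mul]; ring
    rw [this, integral_sub (hi h.2.1) (hi h'.2.1)]
    linarith
  rw [EventuallyEq, ae_restrict_iff' hΩ.measurableSet]
  filter_upwards [ae_all_iff.2 key] with x hx hxΩ
  ext i
  linarith [hx i hxΩ]

lemma fderiv_single_eq_gradient (φ : Sp N → ℝ) (x : Sp N) (i : Fin N) :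
    fderiv ℝ φ x (EuclideanSpace.single i 1) = gradient φ x i := by
  rw [gradient, ← InnerProductSpace.toDual_symm_apply (𝕜 := ℝ), EuclideanSpace.inner_single_right]
  simp

lemma norm_gradient (φ : Sp N → ℝ) (x : Sp N) : ‖gradient φ x‖ = ‖fderiv ℝ φ x‖ := by
  rw [gradient, LinearIsometryEquiv.norm_map]

namespace IsTestFunction

variable {Ω : Set (Sp N)} {φ : Sp N → ℝ}

lemma continuous (h : IsTestFunction Ω φ) : Continuous φ := h.1.continuous

lemma differentiable (h : IsTestFunction Ω φ) : Differentiable ℝ φ := h.1.differentiable (by simp)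

lemma continuous_gradient (h : IsTestFunction Ω φ) : Continuous (gradient φ) :=
  (LinearIsometryEquiv.continuous _).comp (h.1.continuous_fderiv (by simp))

lemma hasCompactSupport_gradient (h : IsTestFunction Ω φ) : HasCompactSupport (gradient φ) :=
  (h.2.1.fderiv ℝ).comp_left (map_zero _)

lemma memLp (h : IsTestFunction Ω φ) (p : ENNReal) (μ : Measure (Sp N))
    [IsFiniteMeasureOnCompacts μ] : MemLp φ p μ :=
  h.continuous.memLp_of_hasCompactSupport h.2.1

lemma memLp_gradient (h : IsTestFunction Ω φ) (p : ENNReal) (μ : Measure (Sp N))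
    [IsFiniteMeasureOnCompacts μ] : MemLp (gradient φ) p μ :=
  h.continuous_gradient.memLp_of_hasCompactSupport h.hasCompactSupport_gradient

lemma eq_zero (h : IsTestFunction Ω φ) {x : Sp N} (hx : x ∉ Ω) : φ x = 0 :=
  image_eq_zero_of_notMem_tsupport fun hx' => hx (h.2.2 hx')

lemma gradient_eq_zero (h : IsTestFunction Ω φ) {x : Sp N} (hx : x ∉ Ω) : gradient φ x = 0 := by
  have : fderiv ℝ φ x = 0 := by
    by_contra h0
    exact hx (h.2.2 (support_fderiv_subset ℝ h0))
  rw [gradient, this, map_zero]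

lemma exists_bound (h : IsTestFunction Ω φ) :
    ∃ C, 0 ≤ C ∧ (∀ x, |φ x| ≤ C) ∧ ∀ x, ‖gradient φ x‖ ≤ C := by
  obtain ⟨C, hC⟩ := h.2.1.exists_bound_of_continuous h.continuous
  obtain ⟨D, hD⟩ := h.hasCompactSupport_gradient.exists_bound_of_continuous h.continuous_gradient
  have h0 : 0 ≤ C := (norm_nonneg _).trans (hC 0)
  exact ⟨max C D, le_max_of_le_left h0, fun x => (hC x).trans (le_max_left _ _),
    fun x => (hD x).trans (le_max_right _ _)⟩

/-- The classical gradient of a test function is its weak gradient. -/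
lemma integral_mul_fderiv (h : IsTestFunction univ φ) {ξ : Sp N → ℝ} (hξ : IsTestFunction univ ξ)
    (i : Fin N) : ∫ x, φ x * fderiv ℝ ξ x (EuclideanSpace.single i 1)
      = - ∫ x, gradient φ x i * ξ x := by
  simp_rw [← fderiv_single_eq_gradient]
  have hc : ∀ {η : Sp N → ℝ}, IsTestFunction univ η →
      Continuous (fun x => fderiv ℝ η x (EuclideanSpace.single i 1)) := fun h =>
    (h.1.continuous_fderiv (by simp)).clm_apply continuous_const
  refine integral_mul_fderiv_eq_neg_fderiv_mul_of_integrable ?_ ?_ ?_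
    (fun x _ => h.differentiable x) (fun x _ => hξ.differentiable x)
  · exact ((hc h).mul hξ.continuous).integrable_of_hasCompactSupport hξ.2.1.mul_left
  · exact (h.continuous.mul (hc hξ)).integrable_of_hasCompactSupport h.2.1.mul_right
  · exact (h.continuous.mul hξ.continuous).integrable_of_hasCompactSupport h.2.1.mul_right

lemma mono (h : IsTestFunction Ω φ) {Ω' : Set (Sp N)} (hs : Ω ⊆ Ω') : IsTestFunction Ω' φ :=
  ⟨h.1, h.2.1, h.2.2.trans hs⟩

end IsTestFunction

/-! ### Limits of test functions; product and chain rule -/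

lemma MemLp.coord {α : Type*} [MeasurableSpace α] {μ : Measure α} {p : ENNReal} {G : α → Sp N}
    (h : MemLp G p μ) (i : Fin N) : MemLp (fun x => G x i) p μ :=
  (EuclideanSpace.proj (𝕜 := ℝ) i).comp_memLp' h

/-- Weak gradients pass to the limit in `L^p`. -/
lemma hasWeakGradient_of_tendsto {U : Set (Sp N)} {p : ENNReal} [Fact (1 ≤ p)]
    {f : ℕ → Sp N → ℝ} (hf : ∀ n, IsTestFunction univ (f n)) {v : Sp N → ℝ} {G : Sp N → Sp N}
    (hv : MemLp v p (volume.restrict U)) (hG : MemLp G p (volume.restrict U))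
    (hfv : Tendsto (fun n => eLpNorm (fun x => v x - f n x) p (volume.restrict U)) atTop (𝓝 0))
    (hfG : Tendsto (fun n => eLpNorm (fun x => G x - gradient (f n) x) p (volume.restrict U))
      atTop (𝓝 0)) : HasWeakGradient U v G := by
  have hp : 1 ≤ p := Fact.out
  refine ⟨locallyIntegrableOn_of_locallyIntegrable_restrict (hv.locallyIntegrable hp),
    locallyIntegrableOn_of_locallyIntegrable_restrict (hG.locallyIntegrable hp), ?_⟩
  intro ξ hξ i
  have hξ' := hξ.mono (subset_univ U)
  have t1 := tendsto_integral_mul_of_tendsto_eLpNorm (p' := p.conjExponent) hv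
    (fun n => (hf n).memLp p _)
    (ξ := fun x => fderiv ℝ ξ x (EuclideanSpace.single i 1)) (by
      simp_rw [fderiv_single_eq_gradient]
      exact MemLp.coord (hξ.memLp_gradient _ _) i) hfv
  have t2 := tendsto_integral_mul_of_tendsto_eLpNorm (p' := p.conjExponent)
    (MemLp.coord hG i)
    (fun n => MemLp.coord ((hf n).memLp_gradient p _) i) (hξ.memLp p.conjExponent _) (by
      refine tendsto_of_tendsto_of_tendsto_of_le_of_le tendsto_const_nhds hfG
        (fun n => zero_le) fun n => ?_
      exact eLpNorm_mono fun x => PiLp.norm_apply_le (G x - gradient (f n) x) i)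
  refine tendsto_nhds_unique t1 ?_
  convert t2.neg using 2 with n
  rw [setIntegral_eq_integral_of_forall_compl_eq_zero,
    setIntegral_eq_integral_of_forall_compl_eq_zero, (hf n).integral_mul_fderiv hξ']
  · intro x hx; rw [hξ.eq_zero hx, mul_zero]
  · intro x hx; rw [fderiv_single_eq_gradient, hξ.gradient_eq_zero hx]; simp

/-- Limits of test functions in `W^{1,p}(Ω)` belong to `X_0^{s,p}(Ω)`. -/
lemma memX_of_tendsto {p : ℝ} (hp : 1 ≤ p) {Ω : Set (Sp N)} (hΩ : IsOpen Ω)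
    {f : ℕ → Sp N → ℝ} (hf : ∀ n, IsTestFunction Ω (f n)) {v : Sp N → ℝ} {G : Sp N → Sp N}
    (hv : MemLp v (ENNReal.ofReal p) (volume.restrict Ω))
    (hG : MemLp G (ENNReal.ofReal p) (volume.restrict Ω))
    (hfv : Tendsto (fun n => eLpNorm (fun x => v x - f n x) (ENNReal.ofReal p)
      (volume.restrict Ω)) atTop (𝓝 0))
    (hfG : Tendsto (fun n => eLpNorm (fun x => G x - gradient (f n) x) (ENNReal.ofReal p)
      (volume.restrict Ω)) atTop (𝓝 0))
    (hv0 : ∀ᵐ x, x ∉ Ω → v x = 0) :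
    MemX p Ω v ∧ weakGrad Ω v =ᵐ[volume.restrict Ω] G := by
  have : Fact (1 ≤ ENNReal.ofReal p) := ⟨by simpa using ENNReal.ofReal_le_ofReal hp⟩
  have hf' := fun n => (hf n).mono (subset_univ Ω)
  have w := hasWeakGradient_of_tendsto hf' hv hG hfv hfG
  have hGe : weakGrad Ω v =ᵐ[volume.restrict Ω] G := w.weakGrad.ae_eq hΩ w
  have hm := hΩ.measurableSet
  have e1 : v =ᵐ[volume] Ω.indicator v := by
    filter_upwards [hv0] with x hx
    by_cases h : x ∈ Ω
    · simp [h]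
    · simp [h, hx h]
  refine ⟨⟨⟨?_, Ω.indicator G, ?_, ?_⟩, ⟨⟨hv, G, w, hG⟩, f, hf, hfv, ?_⟩, hv0⟩, hGe⟩
  · rw [Measure.restrict_univ, memLp_congr_ae e1]
    exact (memLp_indicator_iff_restrict hm).2 hv
  -- The approximants vanish outside `Ω`, so they also converge on the whole space to `v` and to the
  -- zero extension of `G`.
  · refine hasWeakGradient_of_tendsto (p := ENNReal.ofReal p) hf' ?_ ?_ ?_ ?_
    · rw [Measure.restrict_univ, memLp_congr_ae e1]
      exact (memLp_indicator_iff_restrict hm).2 hv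
    · rw [Measure.restrict_univ]
      exact (memLp_indicator_iff_restrict hm).2 hG
    · convert hfv using 2 with n
      rw [Measure.restrict_univ, ← eLpNorm_indicator_eq_eLpNorm_restrict hm]
      refine eLpNorm_congr_ae ?_
      filter_upwards [e1] with x hx
      by_cases h : x ∈ Ω
      · simp [h]
      · rw [hx]; simp [h, (hf n).eq_zero h]
    · convert hfG using 2 with n
      rw [Measure.restrict_univ, ← eLpNorm_indicator_eq_eLpNorm_restrict hm]
      congr 1
      ext1 x
      by_cases h : x ∈ Ω
      · simp [h]
      · simp [h, (hf n).gradient_eq_zero h]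
  · rw [Measure.restrict_univ]
    exact (memLp_indicator_iff_restrict hm).2 hG
  · convert hfG using 2 with n
    refine eLpNorm_congr_ae ?_
    filter_upwards [hGe] with x hx
    rw [hx]

lemma gradient_mul_comp {ψ f : Sp N → ℝ} {k : ℝ → ℝ} {x : Sp N} (hψ : DifferentiableAt ℝ ψ x)
    (hf : DifferentiableAt ℝ f x) (hk : DifferentiableAt ℝ k (f x)) :
    gradient (fun y => ψ y * k (f y)) x
      = k (f x) • gradient ψ x + (ψ x * deriv k (f x)) • gradient f x := by
  have h1 : HasFDerivAt (fun y => k (f y)) (deriv k (f x) • fderiv ℝ f x) x :=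
    hk.hasDerivAt.comp_hasFDerivAt x hf.hasFDerivAt
  have h2 : HasFDerivAt (fun y => ψ y * k (f y)) _ x := hψ.hasFDerivAt.mul h1
  simp only [gradient]
  rw [h2.fderiv, map_add, smul_smul, map_smulₛₗ, map_smulₛₗ]
  simp [add_comm]

lemma MemX.memLp_weakGrad {p : ℝ} {Ω : Set (Sp N)} (hΩ : IsOpen Ω) {u : Sp N → ℝ}
    (hu : MemX p Ω u) : MemLp (weakGrad Ω u) (ENNReal.ofReal p) (volume.restrict Ω) := by
  obtain ⟨G, hG, hGp⟩ := hu.2.1.1.2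
  exact (memLp_congr_ae (hG.weakGrad.ae_eq hΩ hG)).2 hGp

lemma MemX.memLp {p : ℝ} {Ω : Set (Sp N)} {u : Sp N → ℝ} (hu : MemX p Ω u) :
    MemLp u (ENNReal.ofReal p) volume := by
  simpa using hu.1.1

/-- Multiplication by a test function of a bounded smooth function of `u ∈ X_0^{s,p}(Ω)`:
product and chain rule. -/
lemma memX_mul_comp {p : ℝ} (hp : 1 ≤ p) {Ω : Set (Sp N)} (hΩ : IsOpen Ω) {u : Sp N → ℝ}
    (hu : MemX p Ω u) {ψ : Sp N → ℝ} (hψ : IsTestFunction Ω ψ) {k : ℝ → ℝ} (hk : ContDiff ℝ ∞ k)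
    {A B : ℝ} (hA : ∀ t, |k t| ≤ A) (hB : ∀ t, |deriv k t| ≤ B) :
    MemX p Ω (fun x => ψ x * k (u x)) ∧ weakGrad Ω (fun x => ψ x * k (u x))
      =ᵐ[volume.restrict Ω] fun x =>
        k (u x) • gradient ψ x + (ψ x * deriv k (u x)) • weakGrad Ω u x := by
  have hp1 : 1 ≤ ENNReal.ofReal p := by simpa using ENNReal.ofReal_le_ofReal hp
  have hp0 : ENNReal.ofReal p ≠ 0 := (zero_lt_one.trans_le hp1).ne'
  have hpt : ENNReal.ofReal p ≠ ⊤ := ENNReal.ofReal_ne_top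
  have hW := hu.memLp_weakGrad hΩ
  have huΩ := hu.2.1.1.1
  obtain ⟨-, φ, hφ, hφu, hφW⟩ := hu.2.1
  -- Passing to an a.e. convergent subsequence is needed because `deriv k` is merely bounded and
  -- continuous: its composition with the approximants converges pointwise, not in norm.
  obtain ⟨ns, hns, hae⟩ := (tendstoInMeasure_of_tendsto_eLpNorm hp0
    (fun n => ((hφ n).memLp (ENNReal.ofReal p) _).1) huΩ.1 (by
      refine hφu.congr fun n => ?_
      rw [← eLpNorm_neg]; congr 1; ext x; simp)).exists_seq_tendsto_ae
  obtain ⟨C, hC0, hCψ, hCg⟩ := hψ.exists_bound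
  have hB0 : 0 ≤ B := (abs_nonneg _).trans (hB 0)
  have hkd : Differentiable ℝ k := hk.differentiable (by simp)
  have hkc : Continuous k := hk.continuous
  have hk'c : Continuous (deriv k) := hk.continuous_deriv (by simp)
  have hlip : ∀ a b, |k a - k b| ≤ B * |a - b| := fun a b => by
    have := Convex.norm_image_sub_le_of_norm_deriv_le (f := k) (s := univ) (x := b) (y := a)
      (C := B) (fun t _ => hkd t) (fun t _ => hB t) convex_univ (mem_univ _) (mem_univ _)
    simpa using this
  set f : ℕ → Sp N → ℝ := fun n => φ (ns n)
  have hf : ∀ n, IsTestFunction Ω (f n) := fun n => hφ (ns n)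
  have hfu := hφu.comp hns.tendsto_atTop
  have hfW := hφW.comp hns.tendsto_atTop
  have hψm : AEStronglyMeasurable ψ (volume.restrict Ω) := hψ.continuous.aestronglyMeasurable
  have hgm : AEStronglyMeasurable (gradient ψ) (volume.restrict Ω) :=
    hψ.continuous_gradient.aestronglyMeasurable
  have hkum := hkc.comp_aestronglyMeasurable huΩ.1
  have hk'um := hk'c.comp_aestronglyMeasurable huΩ.1
  have hfm := fun n => (hf n).continuous.aestronglyMeasurable (μ := volume.restrict Ω)
  have hfgm := fun n => (hf n).continuous_gradient.aestronglyMeasurable (μ := volume.restrict Ω)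
  have hkfm := fun n => hkc.comp_aestronglyMeasurable (hfm n)
  have hk'fm := fun n => hk'c.comp_aestronglyMeasurable (hfm n)
  have squeeze : ∀ {a b : ℕ → ENNReal} (K : ℝ), Tendsto b atTop (𝓝 0) →
      (∀ n, a n ≤ ENNReal.ofReal K * b n) → Tendsto a atTop (𝓝 0) := by
    intro a b K hb hab
    refine tendsto_of_tendsto_of_tendsto_of_le_of_le tendsto_const_nhds ?_ (fun n => zero_le) hab
    simpa using ENNReal.Tendsto.const_mul hb (Or.inr ENNReal.ofReal_ne_top)
  refine memX_of_tendsto hp hΩ (f := fun n x => ψ x * k (f n x)) ?_ ?_ ?_ ?_ ?_ ?_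
  · intro n
    refine ⟨hψ.1.mul (hk.comp (hf n).1), hψ.2.1.mul_right, ?_⟩
    exact (tsupport_mul_subset_left).trans hψ.2.2
  · refine (hψ.memLp (ENNReal.ofReal p) (volume.restrict Ω)).of_le_mul (c := A)
      (hψm.mul hkum) (Eventually.of_forall fun x => ?_)
    rw [norm_mul, mul_comm]
    gcongr
    exact hA _
  · refine MemLp.add ?_ ?_
    · refine (hψ.memLp_gradient (ENNReal.ofReal p) (volume.restrict Ω)).of_le_mul (c := A)
        (hkum.smul hgm) (Eventually.of_forall fun x => ?_)
      rw [norm_smul]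
      gcongr
      exact hA _
    · refine hW.of_le_mul (c := C * B) ((hψm.mul hk'um).smul hW.1)
        (Eventually.of_forall fun x => ?_)
      rw [norm_smul, norm_mul]
      gcongr
      exacts [hCψ x, hB _]
  · refine squeeze (C * B) hfu fun n => ?_
    refine eLpNorm_le_mul_eLpNorm_of_ae_le_mul (Eventually.of_forall fun x => ?_) _
    rw [← mul_sub, norm_mul, mul_assoc]
    gcongr
    exacts [hCψ x, hlip _ _]
  -- The first term is small since `k` is Lipschitz, the second since the gradients converge in L^p
  -- with bounded factors, the third by dominated convergence along the subsequence.
  · have hdec : ∀ n x, (k (u x) • gradient ψ x + (ψ x * deriv k (u x)) • weakGrad Ω u x)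
        - gradient (fun x => ψ x * k (f n x)) x
        = ((k (u x) - k (f n x)) • gradient ψ x
          + (ψ x * deriv k (f n x)) • (weakGrad Ω u x - gradient (f n) x))
          + (ψ x * (deriv k (u x) - deriv k (f n x))) • weakGrad Ω u x := by
      intro n x
      rw [gradient_mul_comp (hψ.differentiable x) ((hf n).differentiable x) (hkd _)]
      module
    simp_rw [hdec]
    have t1 : Tendsto (fun n => eLpNorm (fun x => (k (u x) - k (f n x)) • gradient ψ x)
        (ENNReal.ofReal p) (volume.restrict Ω)) atTop (𝓝 0) := by
      refine squeeze (B * C) hfu fun n => ?_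
      refine eLpNorm_le_mul_eLpNorm_of_ae_le_mul (Eventually.of_forall fun x => ?_) _
      rw [norm_smul, mul_right_comm]
      gcongr
      exacts [hlip _ _, hCg x]
    have t2 : Tendsto (fun n => eLpNorm (fun x => (ψ x * deriv k (f n x)) •
        (weakGrad Ω u x - gradient (f n) x)) (ENNReal.ofReal p) (volume.restrict Ω))
        atTop (𝓝 0) := by
      refine squeeze (C * B) hfW fun n => ?_
      refine eLpNorm_le_mul_eLpNorm_of_ae_le_mul (Eventually.of_forall fun x => ?_) _
      rw [norm_smul, norm_mul]
      gcongr
      exacts [hCψ x, hB _]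
    have t3 : Tendsto (fun n => eLpNorm (fun x => (ψ x * (deriv k (u x) - deriv k (f n x))) •
        weakGrad Ω u x) (ENNReal.ofReal p) (volume.restrict Ω)) atTop (𝓝 0) := by
      refine tendsto_eLpNorm_of_dominated hp0 hpt
        (fun n => (hψm.mul (hk'um.sub (hk'fm n))).smul hW.1) (hW.norm.const_mul (C * (B + B)))
        (fun n => Eventually.of_forall fun x => ?_) ?_
      · rw [norm_smul, norm_mul]
        gcongr
        exacts [hCψ x, (norm_sub_le _ _).trans (add_le_add (hB _) (hB _))]
      · filter_upwards [hae] with x hx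
        have : Tendsto (fun n => (ψ x * (deriv k (u x) - deriv k (f n x))) • weakGrad Ω u x)
            atTop (𝓝 ((ψ x * (deriv k (u x) - deriv k (u x))) • weakGrad Ω u x)) :=
          (tendsto_const_nhds.mul (tendsto_const_nhds.sub
            ((hk'c.tendsto _).comp hx))).smul_const _
        simpa using this
    refine tendsto_of_tendsto_of_tendsto_of_le_of_le tendsto_const_nhds
      (by simpa using (t1.add t2).add t3) (fun n => zero_le) fun n => ?_
    have m1 := (hkum.sub (hkfm n)).smul hgm
    have m2 := (hψm.mul (hk'fm n)).smul (hW.1.sub (hfgm n))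
    have m3 := (hψm.mul (hk'um.sub (hk'fm n))).smul hW.1
    exact (eLpNorm_add_le (m1.add m2) m3 hp1).trans
      (add_le_add (eLpNorm_add_le m1 m2 hp1) le_rfl)
  · exact Eventually.of_forall fun x hx => by simp [hψ.eq_zero hx]

/-- Around every point of an open set there is a nonnegative test function. -/
lemma exists_isTestFunction_pos {Ω : Set (Sp N)} (hΩ : IsOpen Ω) {x : Sp N} (hx : x ∈ Ω) :
    ∃ ψ, IsTestFunction Ω ψ ∧ (∀ y, 0 ≤ ψ y) ∧ ∀ᶠ y in 𝓝 x, 0 < ψ y := by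
  obtain ⟨ψ, hs, hc, hψ, hr, h1⟩ := exists_contDiff_tsupport_subset (n := ⊤) (hΩ.mem_nhds hx)
  refine ⟨ψ, ⟨hψ, hc, hs⟩, fun y => (hr (mem_range_self y)).1, ?_⟩
  exact hψ.continuous.continuousAt.eventually (lt_mem_nhds (by rw [h1]; exact one_pos))

/-! ### The gradient on the zero set -/

lemma hasWeakGradient_zero {Ω : Set (Sp N)} : HasWeakGradient Ω (0 : Sp N → ℝ) 0 :=
  ⟨locallyIntegrableOn_zero, locallyIntegrableOn_zero, fun φ _ i => by simp⟩

/-- The weak gradient vanishes almost everywhere on the zero set. -/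
lemma MemX.weakGrad_eq_zero {p : ℝ} (hp : 1 ≤ p) {Ω : Set (Sp N)} (hΩ : IsOpen Ω)
    {u : Sp N → ℝ} (hu : MemX p Ω u) :
    ∀ᵐ x ∂(volume.restrict Ω), u x = 0 → weakGrad Ω u x = 0 := by
  have hp1 : 1 ≤ ENNReal.ofReal p := by simpa using ENNReal.ofReal_le_ofReal hp
  have : Fact (1 ≤ ENNReal.ofReal p) := ⟨hp1⟩
  have hW := hu.memLp_weakGrad hΩ
  have huΩ := hu.2.1.1.1
  let χ : ℝ → ℝ := indicator {0} 1
  have hχ : Measurable χ := measurable_one.indicator (measurableSet_singleton 0)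
  have hχ1 : ∀ t, |χ t| ≤ 1 := fun t => by
    by_cases h : t = 0 <;> simp [χ, h]
  have hχu : AEStronglyMeasurable (fun x => χ (u x)) (volume.restrict Ω) :=
    (hχ.comp_aemeasurable huΩ.1.aemeasurable).aestronglyMeasurable
  -- These functions tend to 0 uniformly, while their derivatives stay in [0, 1] and tend to the
  -- indicator `χ` of {0}. Hence ψ kₙ(u) → 0 while its gradient tends to ψ χ(u) ∇u, which must
  -- therefore be the weak gradient of 0.
  let k : ℕ → ℝ → ℝ := fun n t => (n + 1 : ℝ)⁻¹ * Real.arctan ((n + 1) * t)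
  have hn0 : ∀ n : ℕ, (0 : ℝ) < n + 1 := fun n => by positivity
  have hk : ∀ n, ContDiff ℝ ∞ (k n) := fun n =>
    contDiff_const.mul (Real.contDiff_arctan.comp (contDiff_const.mul contDiff_id))
  have hinv : ∀ n : ℕ, (n + 1 : ℝ)⁻¹ ≤ 1 := fun n => inv_le_one_of_one_le₀ (by simp)
  have hkn : ∀ n t, |k n t| ≤ (n + 1 : ℝ)⁻¹ * 2 := fun n t => by
    rw [abs_mul, abs_of_pos (inv_pos.2 (hn0 n))]
    gcongr
    rw [abs_le]
    constructor <;> linarith [Real.arctan_lt_pi_div_two ((n + 1) * t),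
      Real.neg_pi_div_two_lt_arctan ((n + 1) * t), Real.pi_le_four]
  have hkb : ∀ n t, |k n t| ≤ 2 := fun n t => (hkn n t).trans (by linarith [hinv n])
  have hk' : ∀ n t, deriv (k n) t = (1 + ((n + 1) * t) ^ 2)⁻¹ := fun n t => by
    have h := ((((hasDerivAt_id t).const_mul (n + 1 : ℝ)).arctan).const_mul (n + 1 : ℝ)⁻¹)
    rw [HasDerivAt.deriv (f := k n) h]
    have := (hn0 n).ne'
    simp only [id]
    field_simp
  have hk'b : ∀ n t, |deriv (k n) t| ≤ 1 := fun n t => by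
    rw [hk', abs_of_nonneg (by positivity)]
    exact inv_le_one_of_one_le₀ (by nlinarith [sq_nonneg ((n + 1) * t)])
  have hkt : ∀ t, Tendsto (fun n => k n t) atTop (𝓝 0) := fun t => by
    refine squeeze_zero_norm (fun n => hkn n t) ?_
    simpa [one_div] using (tendsto_one_div_add_atTop_nhds_zero_nat (𝕜 := ℝ)).mul_const 2
  have hk't : ∀ t, Tendsto (fun n => deriv (k n) t) atTop (𝓝 (χ t)) := fun t => by
    simp_rw [hk']
    by_cases h : t = 0
    · simp [χ, h]
    · have e : χ t = 0 := by simp [χ, h]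
      rw [e]
      refine tendsto_inv_atTop_zero.comp (tendsto_atTop_add_const_left _ _ ?_)
      have ht : Tendsto (fun n : ℕ => ((n : ℝ) + 1) * |t|) atTop atTop :=
        (tendsto_atTop_add_const_right _ _ tendsto_natCast_atTop_atTop).atTop_mul_const
          (abs_pos.2 h)
      refine ((tendsto_pow_atTop two_ne_zero).comp ht).congr fun n => ?_
      simp [mul_pow]
  have main : ∀ ψ, IsTestFunction Ω ψ →
      (fun x => (ψ x * χ (u x)) • weakGrad Ω u x) =ᵐ[volume.restrict Ω] 0 := by
    intro ψ hψ
    obtain ⟨C, hC0, hCψ, hCg⟩ := hψ.exists_bound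
    have hG : MemLp (fun x => (ψ x * χ (u x)) • weakGrad Ω u x) (ENNReal.ofReal p)
        (volume.restrict Ω) := by
      refine hW.of_le_mul (c := C * 1)
        ((hψ.continuous.aestronglyMeasurable.mul hχu).smul hW.1)
        (Eventually.of_forall fun x => ?_)
      rw [norm_smul, norm_mul]
      gcongr
      exacts [hCψ x, hχ1 _]
    refine HasWeakGradient.ae_eq hΩ (u := 0) ⟨locallyIntegrableOn_zero,
      locallyIntegrableOn_of_locallyIntegrable_restrict (hG.locallyIntegrable hp1), ?_⟩
      hasWeakGradient_zero
    intro ξ hξ i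
    have hX := fun n => memX_mul_comp hp hΩ hu hψ (hk n) (hkb n) (hk'b n)
    have hkm := fun n => (hk n).continuous.comp_aestronglyMeasurable huΩ.1
    have hk'm := fun n => ((hk n).continuous_deriv (by simp)).comp_aestronglyMeasurable huΩ.1
    have hψm : AEStronglyMeasurable ψ (volume.restrict Ω) := hψ.continuous.aestronglyMeasurable
    have hξm : AEStronglyMeasurable ξ (volume.restrict Ω) := hξ.continuous.aestronglyMeasurable
    have eqn : ∀ n, ∫ x in Ω, (ψ x * k n (u x)) * fderiv ℝ ξ x (EuclideanSpace.single i 1)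
        = - ∫ x in Ω, (k n (u x) * gradient ψ x i
          + (ψ x * deriv (k n) (u x)) * weakGrad Ω u x i) * ξ x := by
      intro n
      obtain ⟨G, hG, -⟩ := (hX n).1.2.1.1.2
      rw [hG.weakGrad.2.2 ξ hξ i]
      congr 1
      refine integral_congr_ae ?_
      filter_upwards [(hX n).2] with x hx
      rw [hx]
      simp
    have hWi := MemLp.coord hW i
    have t1 : Tendsto (fun n => ∫ x in Ω, (ψ x * k n (u x)) *
        fderiv ℝ ξ x (EuclideanSpace.single i 1)) atTop (𝓝 (∫ x in Ω, (0 : ℝ))) := by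
      simp_rw [fderiv_single_eq_gradient]
      have hgi := MemLp.coord (hξ.memLp_gradient 1 (volume.restrict Ω)) i
      refine tendsto_integral_of_dominated_convergence (fun x => C * 2 * ‖gradient ξ x i‖)
        (fun n => (hψm.mul (hkm n)).mul hgi.1)
        ((memLp_one_iff_integrable.1 hgi).norm.const_mul _)
        (fun n => Eventually.of_forall fun x => ?_) (Eventually.of_forall fun x => ?_)
      · rw [norm_mul, norm_mul]
        gcongr
        exacts [hCψ x, hkb _ _]
      · simpa using ((hkt (u x)).const_mul (ψ x)).mul_const (gradient ξ x i)
    have t2 : Tendsto (fun n => ∫ x in Ω, (k n (u x) * gradient ψ x i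
          + (ψ x * deriv (k n) (u x)) * weakGrad Ω u x i) * ξ x) atTop
        (𝓝 (∫ x in Ω, (ψ x * χ (u x) * weakGrad Ω u x i) * ξ x)) := by
      have hgi := (MemLp.coord (hψ.memLp_gradient 1 (volume.restrict Ω)) i).1
      refine tendsto_integral_of_dominated_convergence
        (fun x => 2 * C * ‖ξ x‖ + C * 1 * ‖weakGrad Ω u x i * ξ x‖)
        (fun n => (((hkm n).mul hgi).add ((hψm.mul (hk'm n)).mul hWi.1)).mul hξm)
        (((memLp_one_iff_integrable.1 (hξ.memLp 1 _)).norm.const_mul _).add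
          ((hWi.integrable_mul (hξ.memLp (ENNReal.ofReal p).conjExponent _)).norm.const_mul _))
        (fun n => Eventually.of_forall fun x => ?_) (Eventually.of_forall fun x => ?_)
      · rw [add_mul]
        refine (norm_add_le _ _).trans (add_le_add ?_ ?_)
        · rw [norm_mul, norm_mul]
          gcongr
          exacts [hkb _ _, (PiLp.norm_apply_le _ i).trans (hCg x)]
        · rw [mul_assoc, norm_mul, norm_mul]
          gcongr
          exacts [hCψ x, hk'b _ _]
      · simpa using (((hkt (u x)).mul_const (gradient ψ x i)).add
          (((hk't (u x)).const_mul (ψ x)).mul_const (weakGrad Ω u x i))).mul_const (ξ x)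
    have := tendsto_nhds_unique t1 (t2.neg.congr fun n => (eqn n).symm)
    simpa using this
  rw [ae_restrict_iff' hΩ.measurableSet, ae_iff]
  -- `main` only gives the claim where ψ ≠ 0, so it is localised near each point with a ψ that is
  -- positive there.
  refine measure_null_of_locally_null _ fun x hx => ?_
  have hxΩ : x ∈ Ω := by
    by_contra h
    exact hx fun h' => absurd h' h
  obtain ⟨ψ, hψ, -, hpos⟩ := exists_isTestFunction_pos hΩ hxΩ
  have h := main ψ hψ
  rw [EventuallyEq, ae_restrict_iff' hΩ.measurableSet, ae_iff] at h
  refine ⟨_, inter_mem_nhdsWithin _ hpos, measure_mono_null ?_ h⟩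
  rintro y ⟨hy, hy'⟩
  simp only [mem_ofPred_eq, Classical.not_imp] at hy hy' ⊢
  refine ⟨hy.1, ?_⟩
  simp [χ, hy.2.1, hy.2.2, hy'.ne']

/-! ### Translation estimates and the Gagliardo seminorm -/

/-- Jensen's inequality, read off from the monotonicity of L^p norms on a probability space. -/
lemma rpow_lintegral_le_of_isProbabilityMeasure {α : Type*} [MeasurableSpace α] {μ : Measure α}
    [IsProbabilityMeasure μ] {p : ℝ} (hp : 1 ≤ p) {f : α → ENNReal} (hf : AEMeasurable f μ) :
    (∫⁻ x, f x ∂μ) ^ p ≤ ∫⁻ x, f x ^ p ∂μ := by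
  have hp1 : 1 ≤ ENNReal.ofReal p := by simpa using ENNReal.ofReal_le_ofReal hp
  have hp0 : 0 < p := zero_lt_one.trans_le hp
  have h := eLpNorm_le_eLpNorm_of_exponent_le hp1 (μ := μ) hf.aestronglyMeasurable
  rw [eLpNorm_one_eq_lintegral_enorm, eLpNorm_eq_lintegral_rpow_enorm_toReal
    (zero_lt_one.trans_le hp1).ne' ENNReal.ofReal_ne_top, ENNReal.toReal_ofReal hp0.le, one_div,
    ENNReal.le_rpow_inv_iff hp0] at h
  simpa using h

/-- The `L^p` norm of a difference is controlled by the gradient. -/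
lemma IsTestFunction.eLpNorm_translate_sub_le {Ω : Set (Sp N)} {φ : Sp N → ℝ}
    (hφ : IsTestFunction Ω φ) {p : ℝ} (hp : 1 ≤ p) (h : Sp N) :
    eLpNorm (fun x => φ (x + h) - φ x) (ENNReal.ofReal p) volume
      ≤ ENNReal.ofReal ‖h‖ * eLpNorm (gradient φ) (ENNReal.ofReal p) volume := by
  have hp1 : 1 ≤ ENNReal.ofReal p := by simpa using ENNReal.ofReal_le_ofReal hp
  have hp0 : 0 < p := zero_lt_one.trans_le hp
  have hpz := (zero_lt_one.trans_le hp1).ne'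
  let μ : Measure ℝ := volume.restrict (Ioc 0 1)
  have hμ : IsProbabilityMeasure μ := ⟨by simp [μ]⟩
  have hc : ∀ x, Continuous fun t : ℝ => x + t • h := fun x => by fun_prop
  have hgc := hφ.continuous_gradient
  have pt : ∀ x, ‖φ (x + h) - φ x‖ₑ ^ p ≤
      (∫⁻ t, ‖gradient φ (x + t • h)‖ₑ ^ p ∂μ) * ENNReal.ofReal ‖h‖ ^ p := by
    intro x
    -- The increment is the integral of the derivative along the segment from x to x + h. Jensen in
    -- t, and below Tonelli with translation invariance in x, give the estimate.
    have e : ∫ t in (0 : ℝ)..1, fderiv ℝ φ (x + t • h) h = φ (x + h) - φ x := by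
      have := intervalIntegral.integral_eq_sub_of_hasDerivAt (a := (0 : ℝ)) (b := 1)
        (f := fun t : ℝ => φ (x + t • h)) (f' := fun t => fderiv ℝ φ (x + t • h) h) ?_ ?_
      · simpa using this
      · intro t _
        have h1 : HasDerivAt (fun t : ℝ => x + t • h) h t := by
          simpa using ((hasDerivAt_id t).smul_const h).const_add x
        exact (hφ.differentiable _).hasFDerivAt.comp_hasDerivAt t h1
      · exact (((hφ.1.continuous_fderiv (by simp)).comp (hc x)).clm_apply
          continuous_const).intervalIntegrable _ _
    rw [← e, intervalIntegral.integral_of_le zero_le_one]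
    calc _ ≤ (∫⁻ t, ‖gradient φ (x + t • h)‖ₑ * ENNReal.ofReal ‖h‖ ∂μ) ^ p := by
          gcongr
          refine (enorm_integral_le_lintegral_enorm _).trans (lintegral_mono fun t => ?_)
          rw [ofReal_norm, ← enorm_norm (gradient φ _), norm_gradient, enorm_norm]
          exact ContinuousLinearMap.le_opENorm _ _
      _ = (∫⁻ t, ‖gradient φ (x + t • h)‖ₑ ∂μ) ^ p * ENNReal.ofReal ‖h‖ ^ p := by
          rw [lintegral_mul_const' _ _ ENNReal.ofReal_ne_top, ENNReal.mul_rpow_of_nonneg _ _ hp0.le]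
      _ ≤ _ := by
          gcongr
          exact rpow_lintegral_le_of_isProbabilityMeasure hp
            (hgc.comp (hc x)).enorm.measurable.aemeasurable
  rw [eLpNorm_eq_lintegral_rpow_enorm_toReal hpz ENNReal.ofReal_ne_top,
    eLpNorm_eq_lintegral_rpow_enorm_toReal hpz ENNReal.ofReal_ne_top, ENNReal.toReal_ofReal hp0.le,
    one_div, ENNReal.rpow_inv_le_iff hp0, ENNReal.mul_rpow_of_nonneg _ _ hp0.le,
    ← ENNReal.rpow_mul, inv_mul_cancel₀ hp0.ne', ENNReal.rpow_one]
  calc _ ≤ ∫⁻ x, (∫⁻ t, ‖gradient φ (x + t • h)‖ₑ ^ p ∂μ) * ENNReal.ofReal ‖h‖ ^ p :=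
        lintegral_mono pt
    _ = (∫⁻ x, ∫⁻ t, ‖gradient φ (x + t • h)‖ₑ ^ p ∂μ) * ENNReal.ofReal ‖h‖ ^ p :=
        lintegral_mul_const' _ _ (ENNReal.rpow_ne_top_of_nonneg hp0.le ENNReal.ofReal_ne_top)
    _ = (∫⁻ t, (∫⁻ x, ‖gradient φ (x + t • h)‖ₑ ^ p) ∂μ) * ENNReal.ofReal ‖h‖ ^ p := by
        rw [lintegral_lintegral_swap]
        refine Measurable.aemeasurable (Measurable.pow_const (Continuous.measurable ?_) _)
        exact (hgc.comp (by fun_prop : Continuous fun z : Sp N × ℝ => z.1 + z.2 • h)).enorm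
    _ = (∫⁻ _t, (∫⁻ x, ‖gradient φ x‖ₑ ^ p) ∂μ) * ENNReal.ofReal ‖h‖ ^ p := by
        simp_rw [lintegral_add_right_eq_self fun x => ‖gradient φ x‖ₑ ^ p]
    _ ≤ _ := by simp [mul_comm]

/-- By density: translation preserves the L^p norm, so the estimate for test functions passes to the
limit. -/
lemma MemX.eLpNorm_translate_sub_le {p : ℝ} (hp : 1 ≤ p) {Ω : Set (Sp N)} (hΩ : IsOpen Ω)
    {u : Sp N → ℝ} (hu : MemX p Ω u) (h : Sp N) :
    eLpNorm (fun x => u (x + h) - u x) (ENNReal.ofReal p) volume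
      ≤ ENNReal.ofReal ‖h‖ * eLpNorm (weakGrad Ω u) (ENNReal.ofReal p) (volume.restrict Ω) := by
  have hp1 : 1 ≤ ENNReal.ofReal p := by simpa using ENNReal.ofReal_le_ofReal hp
  have hm := hΩ.measurableSet
  have hW := hu.memLp_weakGrad hΩ
  have hup := hu.memLp
  obtain ⟨-, φ, hφ, hφu, hφW⟩ := hu.2.1
  have e1 : ∀ n, eLpNorm (fun x => u x - φ n x) (ENNReal.ofReal p) (volume.restrict Ω)
      = eLpNorm (u - φ n) (ENNReal.ofReal p) volume := by
    intro n
    rw [← eLpNorm_indicator_eq_eLpNorm_restrict hm]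
    refine eLpNorm_congr_ae ?_
    filter_upwards [hu.2.2] with x hx
    by_cases h : x ∈ Ω
    · simp [h]
    · simp [h, hx h, (hφ n).eq_zero h]
  have e2 : ∀ n, eLpNorm (gradient (φ n)) (ENNReal.ofReal p) volume ≤
      eLpNorm (weakGrad Ω u) (ENNReal.ofReal p) (volume.restrict Ω) +
      eLpNorm (fun x => weakGrad Ω u x - gradient (φ n) x)
        (ENNReal.ofReal p) (volume.restrict Ω) := by
    intro n
    have : gradient (φ n) = Ω.indicator (gradient (φ n)) := by
      ext1 x
      by_cases h : x ∈ Ω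
      · simp [h]
      · simp [h, (hφ n).gradient_eq_zero h]
    conv_lhs => rw [this, eLpNorm_indicator_eq_eLpNorm_restrict hm]
    have hg := (hφ n).memLp_gradient (ENNReal.ofReal p) (volume.restrict Ω)
    refine le_trans (le_of_eq ?_) (eLpNorm_sub_le hW.1 (hW.sub hg).1 hp1)
    congr 1
    ext1 x
    simp
  have bd : ∀ n, eLpNorm (fun x => u (x + h) - u x) (ENNReal.ofReal p) volume ≤
      (eLpNorm (fun x => u x - φ n x) (ENNReal.ofReal p) (volume.restrict Ω) +
      ENNReal.ofReal ‖h‖ * (eLpNorm (weakGrad Ω u) (ENNReal.ofReal p) (volume.restrict Ω) +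
      eLpNorm (fun x => weakGrad Ω u x - gradient (φ n) x)
        (ENNReal.ofReal p) (volume.restrict Ω))) +
      eLpNorm (fun x => u x - φ n x) (ENNReal.ofReal p) (volume.restrict Ω) := by
    intro n
    rw [e1]
    have hd : AEStronglyMeasurable (u - φ n) volume := hup.1.sub (hφ n).continuous.aestronglyMeasurable
    have mp := measurePreserving_add_right (volume : Measure (Sp N)) h
    have hdt := hd.comp_measurePreserving mp
    have hft : AEStronglyMeasurable (fun x => φ n (x + h) - φ n x) volume :=
      (((hφ n).continuous.comp (by fun_prop)).sub (hφ n).continuous).aestronglyMeasurable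
    have : (fun x => u (x + h) - u x) = ((u - φ n) ∘ (fun x => x + h)
        + fun x => φ n (x + h) - φ n x) - (u - φ n) := by
      ext x; simp
    rw [this]
    refine (eLpNorm_sub_le (hdt.add hft) hd hp1).trans ?_
    gcongr
    refine (eLpNorm_add_le hdt hft hp1).trans ?_
    rw [eLpNorm_comp_measurePreserving hd mp]
    gcongr
    refine ((hφ n).eLpNorm_translate_sub_le hp h).trans ?_
    gcongr
    exact e2 n
  refine ge_of_tendsto' (x := atTop) ?_ bd
  have t1 := ENNReal.Tendsto.const_mul (a := ENNReal.ofReal ‖h‖)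
    (hφW.const_add (eLpNorm (weakGrad Ω u) (ENNReal.ofReal p) (volume.restrict Ω)))
    (Or.inr ENNReal.ofReal_ne_top)
  have t := (hφu.add t1).add hφu
  simpa using t

lemma integral_abs_rpow_le {α : Type*} [MeasurableSpace α] {μ : Measure α} {p : ℝ} (hp : 0 < p)
    {f : α → ℝ} (hf : MemLp f (ENNReal.ofReal p) μ) {M : ℝ} (hM : 0 ≤ M)
    (h : eLpNorm f (ENNReal.ofReal p) μ ≤ ENNReal.ofReal M) : ∫ x, |f x| ^ p ∂μ ≤ M ^ p := by
  rw [hf.eLpNorm_eq_integral_rpow_norm (by simpa using hp) ENNReal.ofReal_ne_top,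
    ENNReal.ofReal_le_ofReal_iff hM, ENNReal.toReal_ofReal hp.le] at h
  have h0 : 0 ≤ ∫ x, |f x| ^ p ∂μ := integral_nonneg fun x => by positivity
  exact (Real.rpow_inv_le_iff_of_pos h0 hM hp).1 h

/-- `w` receives the increments of both functions, so that one statement serves the seminorm and the
nonlocal form. -/
lemma aestronglyMeasurable_gagliardo {u v : Sp N → ℝ} {w : ℝ → ℝ → ℝ}
    (hw : Measurable (Function.uncurry w)) (hu : AEStronglyMeasurable u volume)
    (hv : AEStronglyMeasurable v volume) (r : ℝ) :
    AEStronglyMeasurable (fun z : Sp N × Sp N =>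
      w (u z.1 - u z.2) (v z.1 - v z.2) / ‖z.1 - z.2‖ ^ r) (volume.prod volume) := by
  refine AEMeasurable.aestronglyMeasurable (AEMeasurable.div ?_ ?_)
  · exact hw.comp_aemeasurable (((hu.comp_fst).sub (hu.comp_snd)).aemeasurable.prodMk
      ((hv.comp_fst).sub (hv.comp_snd)).aemeasurable)
  · exact Measurable.aemeasurable (by fun_prop)

/-- Functions in `X_0^{s,p}(Ω)` have finite Gagliardo seminorm of order `s`. -/
lemma MemX.integrable_gagliardo {s p : ℝ} (hN : 1 ≤ N) (hs0 : 0 < s) (hs1 : s < 1) (hp : 1 ≤ p)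
    {Ω : Set (Sp N)} (hΩ : IsOpen Ω) {u : Sp N → ℝ} (hu : MemX p Ω u) :
    Integrable (fun z : Sp N × Sp N => |u z.1 - u z.2| ^ p / ‖z.1 - z.2‖ ^ ((N : ℝ) + s * p))
      (volume.prod volume) := by
  have hp0 : 0 < p := zero_lt_one.trans_le hp
  have hp1 : 1 ≤ ENNReal.ofReal p := by simpa using ENNReal.ofReal_le_ofReal hp
  have hup := hu.memLp
  set r := (N : ℝ) + s * p with hr
  have hmeas : AEStronglyMeasurable (fun z : Sp N × Sp N =>
      |u z.1 - u z.2| ^ p / ‖z.1 - z.2‖ ^ r) (volume.prod volume) :=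
    aestronglyMeasurable_gagliardo (w := fun a _ => |a| ^ p)
      (by simp only [Function.uncurry_def]; fun_prop) hup.1 hup.1 r
  -- Change of variables (h, x) ↦ (x, x + h): the kernel then depends on h alone, and the inner
  -- integral is the L^p norm of an increment, to the power p.
  have mp := measurePreserving_prod_add_swap (volume : Measure (Sp N)) (volume : Measure (Sp N))
  rw [← mp.integrable_comp hmeas]
  have hmeas' := hmeas.comp_measurePreserving mp
  have hmem : ∀ h : Sp N, MemLp (fun x => u (x + h) - u x) (ENNReal.ofReal p) volume := fun h =>
    (hup.comp_measurePreserving (measurePreserving_add_right volume h)).sub hup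
  have hpow : ∀ h x : Sp N, |u x - u (x + h)| = ‖u (x + h) - u x‖ := fun h x => by
    rw [abs_sub_comm, Real.norm_eq_abs]
  have hint : ∀ h : Sp N, Integrable (fun x => ‖u (x + h) - u x‖ ^ p) := fun h => by
    have := (hmem h).integrable_norm_rpow (by simpa using hp0) ENNReal.ofReal_ne_top
    rwa [ENNReal.toReal_ofReal hp0.le] at this
  set M := (eLpNorm (weakGrad Ω u) (ENNReal.ofReal p) (volume.restrict Ω)).toReal with hM
  set L := (eLpNorm u (ENNReal.ofReal p) volume).toReal with hL
  have b1 : ∀ h : Sp N, ∫ x, ‖u (x + h) - u x‖ ^ p ≤ (‖h‖ * M) ^ p := fun h => by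
    refine integral_abs_rpow_le hp0 (hmem h) (by positivity) ?_
    rw [ENNReal.ofReal_mul (norm_nonneg _), hM,
      ENNReal.ofReal_toReal (hu.memLp_weakGrad hΩ).eLpNorm_ne_top]
    exact hu.eLpNorm_translate_sub_le hp hΩ h
  have b2 : ∀ h : Sp N, ∫ x, ‖u (x + h) - u x‖ ^ p ≤ (L + L) ^ p := fun h => by
    refine integral_abs_rpow_le hp0 (hmem h) (by positivity) ?_
    rw [ENNReal.ofReal_add (by positivity) (by positivity), hL,
      ENNReal.ofReal_toReal hup.eLpNorm_ne_top]
    have mp := measurePreserving_add_right (volume : Measure (Sp N)) h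
    refine (eLpNorm_sub_le (hup.comp_measurePreserving mp).1 hup.1 hp1).trans ?_
    rw [eLpNorm_comp_measurePreserving hup.1 mp]
  refine (integrable_prod_iff hmeas').2 ⟨Eventually.of_forall fun h => ?_, ?_⟩
  · simp only [Function.comp_def, sub_add_cancel_left, norm_neg, hpow]
    exact (hint h).div_const _
  have hnorm : (fun h : Sp N => ∫ x, ‖((fun z : Sp N × Sp N =>
      |u z.1 - u z.2| ^ p / ‖z.1 - z.2‖ ^ r) ∘ fun z : Sp N × Sp N => (z.2, z.2 + z.1)) (h, x)‖)
      = fun h => (∫ x, ‖u (x + h) - u x‖ ^ p) / ‖h‖ ^ r := by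
    ext h
    rw [← integral_div]
    congr 1
    ext x
    simp only [Function.comp_def, sub_add_cancel_left, norm_neg, hpow]
    rw [Real.norm_of_nonneg (by positivity)]
  have hm1 := hmeas'.norm.integral_prod_right'
  rw [hnorm] at hm1 ⊢
  have hfr : Module.finrank ℝ (Sp N) = N := by simp
  have hI0 : ∀ h : Sp N, 0 ≤ (∫ x, ‖u (x + h) - u x‖ ^ p) / ‖h‖ ^ r := fun h =>
    div_nonneg (integral_nonneg fun x => by positivity) (by positivity)
  -- Near h = 0, `b1` leaves |h|^(p - r), integrable as r - p = N - (1 - s)p < N. Far away, `b2`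
  -- leaves |h|^(-r), integrable as r > N.
  rw [← integrableOn_univ, ← union_compl_self (Metric.ball (0 : Sp N) 1)]
  refine IntegrableOn.union ?_ ?_
  · refine integrableOn_ball_of_norm_le_rpow (by rw [hfr]; exact hN) (C := M ^ p) (α := r - p)
      (by rw [hfr]; nlinarith) (Eventually.of_forall fun h => ?_) hm1
    rw [Real.norm_of_nonneg (hI0 h)]
    rcases eq_or_ne h 0 with rfl | hne
    · have h0 : ∀ x : Sp N, ‖u (x + 0) - u x‖ ^ p = 0 := fun x => by simp [hp0.ne']
      simp only [h0, integral_zero, zero_div]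
      positivity
    · have hpos : 0 < ‖h‖ := norm_pos_iff.2 hne
      rw [neg_sub, Real.rpow_sub hpos, mul_div_assoc']
      gcongr
      refine (b1 h).trans_eq ?_
      rw [Real.mul_rpow hpos.le (by positivity), mul_comm]
  · have hr0 : 0 < r := by positivity
    -- The factor 2^r comes from 1/|h| ≤ 2/(1 + |h|) for |h| ≥ 1.
    have hi := (integrable_one_add_norm (E := Sp N) (μ := volume) (r := r)
      (by rw [hfr]; simp only [hr]; nlinarith [mul_pos hs0 hp0])).const_mul ((L + L) ^ p * 2 ^ r)
    refine hi.integrableOn.mono' hm1.restrict ?_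
    rw [ae_restrict_iff' Metric.isOpen_ball.measurableSet.compl]
    refine Eventually.of_forall fun h hh => ?_
    have h1 : 1 ≤ ‖h‖ := by simpa using hh
    rw [Real.norm_of_nonneg (hI0 h), mul_assoc, Real.rpow_neg (by positivity), ← div_eq_mul_inv,
      ← Real.div_rpow (by norm_num) (by positivity), div_eq_mul_inv, ← Real.inv_rpow (by positivity)]
    have : ‖h‖⁻¹ ≤ 2 / (1 + ‖h‖) := by
      rw [inv_eq_one_div, div_le_div_iff₀ (by positivity) (by positivity)]; linarith
    have hb := b2 h
    gcongr

lemma abs_rpow_sub_two_mul_self {p : ℝ} (hp : 1 < p) (t : ℝ) :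
    |(|t| ^ (p - 2) * t)| = |t| ^ (p - 1) := by
  rcases eq_or_ne t 0 with rfl | h
  · simp [Real.zero_rpow (by linarith : p - 1 ≠ 0)]
  · have h' := abs_pos.2 h
    rw [abs_mul, abs_of_nonneg (by positivity), ← Real.rpow_add_one h'.ne']
    ring_nf

/-- A crude Young inequality: replace the smaller of the two numbers by the larger. -/
lemma rpow_sub_one_mul_le {p a b : ℝ} (hp : 1 < p) (ha : 0 ≤ a) (hb : 0 ≤ b) :
    a ^ (p - 1) * b ≤ a ^ p + b ^ p := by
  have hs : ∀ c : ℝ, 0 ≤ c → c ^ (p - 1) * c = c ^ p := fun c hc => by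
    rw [← Real.rpow_add_one' hc (by linarith)]; ring_nf
  rcases le_total a b with h | h
  · have : a ^ (p - 1) * b ≤ b ^ (p - 1) * b := by
      gcongr
    rw [hs b hb] at this
    have := Real.rpow_nonneg ha p
    linarith
  · have : a ^ (p - 1) * b ≤ a ^ (p - 1) * a := by gcongr
    rw [hs a ha] at this
    have := Real.rpow_nonneg hb p
    linarith

/-- The nonlocal integrand is integrable on the product space. -/
lemma MemX.integrable_nonlocal {s p : ℝ} (hN : 1 ≤ N) (hs0 : 0 < s) (hs1 : s < 1) (hp : 1 < p)
    {Ω : Set (Sp N)} (hΩ : IsOpen Ω) {u v : Sp N → ℝ} (hu : MemX p Ω u) (hv : MemX p Ω v) :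
    Integrable (fun z : Sp N × Sp N => |u z.1 - u z.2| ^ (p - 2) * (u z.1 - u z.2)
      * (v z.1 - v z.2) / ‖z.1 - z.2‖ ^ ((N : ℝ) + s * p)) (volume.prod volume) := by
  refine ((hu.integrable_gagliardo hN hs0 hs1 hp.le hΩ).add
    (hv.integrable_gagliardo hN hs0 hs1 hp.le hΩ)).mono'
    (aestronglyMeasurable_gagliardo (w := fun a b => |a| ^ (p - 2) * a * b)
      (by simp only [Function.uncurry_def]; fun_prop) hu.memLp.1 hv.memLp.1 _)
    (Eventually.of_forall fun z => ?_)
  simp only [Pi.add_apply]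
  rw [← add_div, Real.norm_eq_abs, abs_div, abs_mul, abs_rpow_sub_two_mul_self hp,
    abs_of_nonneg (by positivity : 0 ≤ ‖z.1 - z.2‖ ^ ((N : ℝ) + s * p))]
  gcongr
  exact rpow_sub_one_mul_le hp (abs_nonneg _) (abs_nonneg _)

/-! ### Gaussian cutoffs and the pointwise inequality -/

/-- The Gaussians `t ↦ exp (-((n + 1) t)²)`, smooth functions decreasing to the indicator of
`{0}`. -/
noncomputable def gaussianCutoff (n : ℕ) (t : ℝ) : ℝ := Real.exp (-(((n : ℝ) + 1) * t) ^ 2)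

namespace gaussianCutoff

lemma contDiff (n : ℕ) : ContDiff ℝ ∞ (gaussianCutoff n) := by
  unfold gaussianCutoff
  fun_prop

lemma nonneg (n : ℕ) (t : ℝ) : 0 ≤ gaussianCutoff n t := (Real.exp_pos _).le

lemma le_one (n : ℕ) (t : ℝ) : gaussianCutoff n t ≤ 1 :=
  Real.exp_le_one_iff.2 (neg_nonpos.2 (sq_nonneg _))

lemma abs_le_one (n : ℕ) (t : ℝ) : |gaussianCutoff n t| ≤ 1 := by
  rw [abs_of_nonneg (nonneg n t)]
  exact le_one n t

@[simp] lemma apply_zero (n : ℕ) : gaussianCutoff n 0 = 1 := by simp [gaussianCutoff]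

lemma antitone_of_nonneg (n : ℕ) {a b : ℝ} (ha : 0 ≤ a) (hab : a ≤ b) :
    gaussianCutoff n b ≤ gaussianCutoff n a := by
  unfold gaussianCutoff
  gcongr

/-- A bound uniform in n, attained at n = 0. It makes both the nonlocal gain and the dominating
function for the potential term independent of n. -/
lemma le_exp (n : ℕ) (t : ℝ) : gaussianCutoff n t ≤ Real.exp (-t ^ 2) := by
  refine Real.exp_le_exp.2 (neg_le_neg ?_)
  have : (0 : ℝ) ≤ n := n.cast_nonneg
  rw [mul_pow]
  nlinarith [sq_nonneg t, mul_nonneg this (sq_nonneg t), sq_nonneg ((n : ℝ) * t)]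

lemma deriv_eq (n : ℕ) (t : ℝ) :
    deriv (gaussianCutoff n) t
      = -(2 * ((n : ℝ) + 1) * ((((n : ℝ) + 1) * t) * gaussianCutoff n t)) := by
  have h := ((((hasDerivAt_id t).const_mul ((n : ℝ) + 1)).pow 2).neg).exp
  rw [HasDerivAt.deriv (f := gaussianCutoff n) h]
  simp [gaussianCutoff]
  ring

lemma deriv_nonpos (n : ℕ) {t : ℝ} (ht : 0 ≤ t) : deriv (gaussianCutoff n) t ≤ 0 := by
  have := nonneg n t
  rw [deriv_eq, neg_nonpos]
  positivity

/-- With τ = (n+1)t this reduces to |τ| ≤ 1 + τ² ≤ exp(τ²). The growth in n is harmless: the bound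
only serves to make the test functions admissible. -/
lemma abs_deriv_le (n : ℕ) (t : ℝ) : |deriv (gaussianCutoff n) t| ≤ 2 * ((n : ℝ) + 1) := by
  rw [deriv_eq, abs_neg, abs_mul, abs_of_nonneg (by positivity : (0 : ℝ) ≤ 2 * (n + 1))]
  refine mul_le_of_le_one_right (by positivity) ?_
  rw [abs_mul, abs_of_nonneg (nonneg n t), gaussianCutoff, Real.exp_neg, ← div_eq_mul_inv,
    div_le_one (Real.exp_pos _)]
  set τ := ((n : ℝ) + 1) * t
  have h1 := Real.add_one_le_exp (τ ^ 2)
  rw [← sq_abs] at h1 ⊢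
  nlinarith [sq_nonneg (|τ| - 1), abs_nonneg τ]

lemma tendsto_zero {t : ℝ} (ht : t ≠ 0) :
    Tendsto (fun n => gaussianCutoff n t) atTop (𝓝 0) := by
  have h : Tendsto (fun n : ℕ => ((n : ℝ) + 1) * |t|) atTop atTop :=
    (tendsto_atTop_add_const_right _ _ tendsto_natCast_atTop_atTop).atTop_mul_const
      (abs_pos.2 ht)
  refine (Real.tendsto_exp_neg_atTop_nhds_zero.comp
    ((tendsto_pow_atTop two_ne_zero).comp h)).congr fun n => ?_
  simp [gaussianCutoff, mul_pow]

end gaussianCutoff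

/-- Combine t ≤ exp t with qt - t² ≤ q². -/
lemma rpow_mul_exp_neg_sq_le {q t : ℝ} (hq : 0 ≤ q) (ht : 0 ≤ t) :
    t ^ q * Real.exp (-t ^ 2) ≤ Real.exp (q ^ 2) := by
  have h1 : t ^ q ≤ Real.exp (q * t) := by
    rw [mul_comm, Real.exp_mul]
    gcongr
    linarith [Real.add_one_le_exp t]
  calc t ^ q * Real.exp (-t ^ 2) ≤ Real.exp (q * t) * Real.exp (-t ^ 2) := by gcongr
    _ ≤ _ := by
      rw [← Real.exp_add, Real.exp_le_exp]
      nlinarith [sq_nonneg (q - t), mul_nonneg hq ht]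

/-- The pointwise inequality behind the strong maximum principle. -/
lemma nonlocal_pointwise_le {p a b P Q : ℝ} (hp : 1 < p) (n : ℕ) (ha : 0 ≤ a) (hb : 0 ≤ b)
    (hP : 0 ≤ P) (hQ : 0 ≤ Q) :
    |a - b| ^ (p - 2) * (a - b) * (P * gaussianCutoff n a - Q * gaussianCutoff n b) ≤
      |a - b| ^ (p - 2) * (a - b) * (P - Q) * gaussianCutoff n (max a b)
        - indicator {0} 1 a * P * (|b| ^ (p - 1) * (1 - Real.exp (-b ^ 2))) := by
  have hpow : 0 ≤ |a - b| ^ (p - 2) := by positivity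
  rcases le_or_gt a b with hab | hab
  -- Here the factor |a-b|^(p-2)(a-b) is nonpositive, so replacing the cutoff at a by the smaller
  -- one at b increases the expression. If a = 0 the cutoff there is 1, and the replacement loses P
  -- |b|^(p-1) (1 - kₙ(b)), which is at least the subtracted term.
  · rw [max_eq_right hab]
    have hJ : |a - b| ^ (p - 2) * (a - b) ≤ 0 :=
      mul_nonpos_of_nonneg_of_nonpos hpow (by linarith)
    have hanti := gaussianCutoff.antitone_of_nonneg n ha hab
    rcases eq_or_ne a 0 with rfl | h0
    · have hJe : |0 - b| ^ (p - 2) * (0 - b) = - |b| ^ (p - 1) := by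
        have := abs_rpow_sub_two_mul_self hp (0 - b)
        rw [abs_of_nonpos hJ] at this
        rw [← neg_eq_iff_eq_neg, this]
        simp
      rw [hJe]
      simp only [mem_singleton_iff, indicator_of_mem, Pi.one_apply, one_mul,
        gaussianCutoff.apply_zero]
      have h1 := gaussianCutoff.le_exp n b
      have h2 : 0 ≤ P * |b| ^ (p - 1) := by positivity
      nlinarith [mul_le_mul_of_nonneg_left h1 h2]
    · rw [indicator_of_notMem (by simpa using h0)]
      nlinarith [mul_nonneg (mul_nonneg (neg_nonneg.2 hJ) hP) (sub_nonneg.2 hanti)]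
  · rw [max_eq_left hab.le, indicator_of_notMem (by simpa using (hb.trans_lt hab).ne')]
    have hJ : 0 ≤ |a - b| ^ (p - 2) * (a - b) := mul_nonneg hpow (by linarith)
    have hanti := gaussianCutoff.antitone_of_nonneg n hb hab.le
    nlinarith [mul_nonneg (mul_nonneg hJ hQ) (sub_nonneg.2 hanti)]

/-! ### The terms of the equation -/

lemma IsTestFunction.memX {p : ℝ} (hp : 1 ≤ p) {Ω : Set (Sp N)} (hΩ : IsOpen Ω) {ψ : Sp N → ℝ}
    (hψ : IsTestFunction Ω ψ) : MemX p Ω ψ :=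
  (memX_of_tendsto hp hΩ (f := fun _ => ψ) (fun _ => hψ) (hψ.memLp _ _) (hψ.memLp_gradient _ _)
    (by simp) (by simp) (Eventually.of_forall fun _ hx => hψ.eq_zero hx)).1

lemma abs_norm_rpow_mul_inner_le {p : ℝ} (hp : 1 < p) {E : Type*} [NormedAddCommGroup E]
    [InnerProductSpace ℝ E] (w y : E) :
    |‖w‖ ^ (p - 2) * inner ℝ w y| ≤ ‖w‖ ^ p + ‖y‖ ^ p := by
  refine le_trans ?_ (rpow_sub_one_mul_le hp (norm_nonneg w) (norm_nonneg y))
  have := abs_rpow_sub_two_mul_self hp ‖w‖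
  rw [abs_norm, abs_of_nonneg (by positivity)] at this
  rw [← this, abs_mul, abs_of_nonneg (by positivity), mul_assoc]
  gcongr
  exact abs_real_inner_le_norm w y

lemma integrable_norm_rpow_mul_inner {α : Type*} [MeasurableSpace α] {μ : Measure α} {p : ℝ}
    (hp : 1 < p) {W Y : α → Sp N} (hW : MemLp W (ENNReal.ofReal p) μ)
    (hY : MemLp Y (ENNReal.ofReal p) μ) :
    Integrable (fun x => ‖W x‖ ^ (p - 2) * inner ℝ (W x) (Y x)) μ := by
  have hi : ∀ {F : α → Sp N}, MemLp F (ENNReal.ofReal p) μ → Integrable (fun x => ‖F x‖ ^ p) μ := by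
    intro F hF
    have := hF.integrable_norm_rpow (by simpa using zero_lt_one.trans hp) ENNReal.ofReal_ne_top
    rwa [ENNReal.toReal_ofReal (zero_lt_one.trans hp).le] at this
  refine ((hi hW).add (hi hY)).mono' ?_ (Eventually.of_forall fun x =>
    abs_norm_rpow_mul_inner_le hp _ _)
  exact (hW.1.norm.aemeasurable.pow_const _).aestronglyMeasurable.mul (hW.1.inner hY.1)

/-- The local part of the form, tested with `ψ exp(-((n+1)u)²)`. -/
lemma exists_local_bound {p : ℝ} (hp : 1 < p) {Ω : Set (Sp N)} (hΩ : IsOpen Ω) {u : Sp N → ℝ}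
    (hu : MemX p Ω u) (hu0 : ∀ᵐ x ∂(volume.restrict Ω), 0 ≤ u x) {ψ : Sp N → ℝ}
    (hψ : IsTestFunction Ω ψ) (hψ0 : ∀ x, 0 ≤ ψ x) :
    ∃ c : ℕ → ℝ, Tendsto c atTop (𝓝 0) ∧ ∀ n,
      ∫ x in Ω, ‖weakGrad Ω u x‖ ^ (p - 2) * inner ℝ (weakGrad Ω u x)
        (weakGrad Ω (fun x => ψ x * gaussianCutoff n (u x)) x) ≤ c n := by
  have hW := hu.memLp_weakGrad hΩ
  have hg := hψ.memLp_gradient (ENNReal.ofReal p) (volume.restrict Ω)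
  have hi := integrable_norm_rpow_mul_inner hp hW hg
  have hum := hu.2.1.1.1.1
  have hcm := fun n => (gaussianCutoff.contDiff n).continuous.comp_aestronglyMeasurable hum
  have hb : ∀ n x, ‖gaussianCutoff n (u x) * (‖weakGrad Ω u x‖ ^ (p - 2) *
      inner ℝ (weakGrad Ω u x) (gradient ψ x))‖ ≤ ‖‖weakGrad Ω u x‖ ^ (p - 2) *
      inner ℝ (weakGrad Ω u x) (gradient ψ x)‖ := fun n x => by
    rw [norm_mul]
    exact mul_le_of_le_one_left (norm_nonneg _) (gaussianCutoff.abs_le_one n _)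
  refine ⟨fun n => ∫ x in Ω, gaussianCutoff n (u x) * (‖weakGrad Ω u x‖ ^ (p - 2) *
    inner ℝ (weakGrad Ω u x) (gradient ψ x)), ?_, fun n => ?_⟩
  · rw [← integral_zero (Sp N) ℝ (μ := volume.restrict Ω)]
    refine tendsto_integral_of_dominated_convergence _ (fun n => (hcm n).mul hi.1) hi.norm
      (fun n => Eventually.of_forall (hb n)) ?_
    -- Where u = 0 the cutoff equals 1 for every n, but there the gradient vanishes.
    filter_upwards [hu.weakGrad_eq_zero hp.le hΩ] with x hx
    rcases eq_or_ne (u x) 0 with h | h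
    · simp [hx h]
    · simpa using (gaussianCutoff.tendsto_zero h).mul_const
        (‖weakGrad Ω u x‖ ^ (p - 2) * inner ℝ (weakGrad Ω u x) (gradient ψ x))
  · obtain ⟨hv, he⟩ := memX_mul_comp hp.le hΩ hu hψ (gaussianCutoff.contDiff n)
      (gaussianCutoff.abs_le_one n) (gaussianCutoff.abs_deriv_le n)
    refine integral_mono_ae (integrable_norm_rpow_mul_inner hp hW (hv.memLp_weakGrad hΩ))
      (hi.norm.mono' ((hcm n).mul hi.1) (Eventually.of_forall (hb n))) ?_
    filter_upwards [he, hu0] with x hx hx0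
    -- The chain rule produces the extra term ψ kₙ'(u) |∇u|^p, which is nonpositive and can be
    -- dropped.
    rw [hx, inner_add_right, inner_smul_right, inner_smul_right, real_inner_self_eq_norm_sq]
    have h1 : 0 ≤ ‖weakGrad Ω u x‖ ^ (p - 2) := by positivity
    have h2 := gaussianCutoff.deriv_nonpos n hx0
    nlinarith [mul_nonneg (mul_nonneg h1 (hψ0 x)) (mul_nonneg (neg_nonneg.2 h2)
      (sq_nonneg ‖weakGrad Ω u x‖))]

/-- The potential term, tested with `ψ exp(-((n+1)u)²)`, tends to zero. -/
lemma tendsto_potential {p : ℝ} (hp : 1 < p) {Ω : Set (Sp N)} {u : Sp N → ℝ}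
    (hu : AEStronglyMeasurable u (volume.restrict Ω)) {V : Sp N → ℝ}
    (hV : Integrable V (volume.restrict Ω)) {ψ : Sp N → ℝ} (hψ : IsTestFunction Ω ψ) :
    Tendsto (fun n => ∫ x in Ω, V x * |u x| ^ (p - 2) * u x * (ψ x * gaussianCutoff n (u x)))
      atTop (𝓝 0) := by
  obtain ⟨C, hC0, hCψ, -⟩ := hψ.exists_bound
  have hψm : AEStronglyMeasurable ψ (volume.restrict Ω) := hψ.continuous.aestronglyMeasurable
  rw [← integral_zero (Sp N) ℝ (μ := volume.restrict Ω)]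
  -- Since t^(p-1) exp(-t²) ≤ exp((p-1)²), the cutoff absorbs the power of u, and integrability of
  -- `V` alone suffices.
  refine tendsto_integral_of_dominated_convergence
    (fun x => ‖V x‖ * (C * Real.exp ((p - 1) ^ 2))) (fun n => ?_) (hV.norm.mul_const _)
    (fun n => Eventually.of_forall fun x => ?_) (Eventually.of_forall fun x => ?_)
  · exact ((hV.1.mul (hu.norm.aemeasurable.pow_const _).aestronglyMeasurable).mul hu).mul
      (hψm.mul ((gaussianCutoff.contDiff n).continuous.comp_aestronglyMeasurable hu))
  · have e : V x * |u x| ^ (p - 2) * u x * (ψ x * gaussianCutoff n (u x))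
        = V x * (ψ x * ((|u x| ^ (p - 2) * u x) * gaussianCutoff n (u x))) := by ring
    rw [e, norm_mul, norm_mul, norm_mul, Real.norm_eq_abs (_ * u x), abs_rpow_sub_two_mul_self hp,
      Real.norm_of_nonneg (gaussianCutoff.nonneg n _)]
    gcongr ?_ * (?_ * ?_)
    · exact mul_nonneg (by positivity) (gaussianCutoff.nonneg n _)
    · exact hCψ x
    · refine le_trans ?_ (rpow_mul_exp_neg_sq_le (by linarith : 0 ≤ p - 1) (abs_nonneg (u x)))
      gcongr
      rw [sq_abs]
      exact gaussianCutoff.le_exp n _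
  · rcases eq_or_ne (u x) 0 with h | h
    · simp [h]
    · simpa using ((gaussianCutoff.tendsto_zero h).const_mul (ψ x)).const_mul
        (V x * |u x| ^ (p - 2) * u x)

/-- The nonlocal part of the form, tested with `ψ exp(-((n+1)u)²)`, stays below a negative constant
if `ψ` charges the zero set of `u ≥ 0`. -/
lemma exists_nonlocal_bound {s p : ℝ} (hN : 1 ≤ N) (hs0 : 0 < s) (hs1 : s < 1) (hp : 1 < p)
    {Ω : Set (Sp N)} (hΩ : IsOpen Ω) {u : Sp N → ℝ} (hu : MemX p Ω u)
    (hu0 : ∀ᵐ x, 0 ≤ u x) (hne : ¬ ∀ᵐ x, u x = 0) {ψ : Sp N → ℝ}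
    (hψ : IsTestFunction Ω ψ) (hψ0 : ∀ x, 0 ≤ ψ x) (hZ : volume {x | u x = 0 ∧ 0 < ψ x} ≠ 0) :
    ∃ c : ℕ → ℝ, Tendsto c atTop (𝓝 0) ∧ ∃ δ > 0, ∀ n,
      ∫ x, ∫ y, |u x - u y| ^ (p - 2) * (u x - u y) *
        (ψ x * gaussianCutoff n (u x) - ψ y * gaussianCutoff n (u y))
        / ‖x - y‖ ^ ((N : ℝ) + s * p) ≤ c n - δ := by
  set r := (N : ℝ) + s * p with hr
  have hum := hu.memLp.1
  have hv := fun n => (memX_mul_comp hp.le hΩ hu hψ (gaussianCutoff.contDiff n)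
      (gaussianCutoff.abs_le_one n) (gaussianCutoff.abs_deriv_le n)).1
  have hI := fun n => hu.integrable_nonlocal hN hs0 hs1 hp hΩ (hv n)
  have hE := hu.integrable_nonlocal hN hs0 hs1 hp hΩ (hψ.memX hp.le hΩ)
  rw [← hr] at hI hE
  have hmax : AEStronglyMeasurable (fun z : Sp N × Sp N => max (u z.1) (u z.2))
      (volume.prod volume) := hum.comp_fst.sup hum.comp_snd
  have hcm := fun n => (gaussianCutoff.contDiff n).continuous.comp_aestronglyMeasurable hmax
  let E : ℕ → Sp N × Sp N → ℝ := fun n z => |u z.1 - u z.2| ^ (p - 2) * (u z.1 - u z.2)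
      * (ψ z.1 - ψ z.2) / ‖z.1 - z.2‖ ^ r * gaussianCutoff n (max (u z.1) (u z.2))
  have hEb : ∀ n z, ‖E n z‖ ≤ ‖|u z.1 - u z.2| ^ (p - 2) * (u z.1 - u z.2)
      * (ψ z.1 - ψ z.2) / ‖z.1 - z.2‖ ^ r‖ := fun n z => by
    rw [norm_mul]
    exact mul_le_of_le_one_right (norm_nonneg _) (gaussianCutoff.abs_le_one n _)
  have hEi : ∀ n, Integrable (E n) (volume.prod volume) := fun n =>
    hE.norm.mono' (hE.1.mul (hcm n)) (Eventually.of_forall (hEb n))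
  -- The gain, independent of n; its integral will be δ.
  let G : Sp N × Sp N → ℝ := fun z => indicator {0} 1 (u z.1) * ψ z.1 *
    (|u z.2| ^ (p - 1) * (1 - Real.exp (-u z.2 ^ 2))) / ‖z.1 - z.2‖ ^ r
  have hG0 : ∀ z, 0 ≤ G z := fun z => by
    have h1 : (0 : ℝ) ≤ indicator {0} 1 (u z.1) := indicator_nonneg (by simp) _
    have h2 : 0 ≤ 1 - Real.exp (-u z.2 ^ 2) :=
      sub_nonneg.2 (Real.exp_le_one_iff.2 (neg_nonpos.2 (sq_nonneg _)))
    have h3 := hψ0 z.1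
    positivity
  have hu1 : ∀ᵐ z : Sp N × Sp N ∂(volume.prod volume), 0 ≤ u z.1 :=
    Measure.quasiMeasurePreserving_fst.ae hu0
  have hu2 : ∀ᵐ z : Sp N × Sp N ∂(volume.prod volume), 0 ≤ u z.2 :=
    Measure.quasiMeasurePreserving_snd.ae hu0
  have hpt : ∀ n, ∀ᵐ z : Sp N × Sp N ∂(volume.prod volume),
      |u z.1 - u z.2| ^ (p - 2) * (u z.1 - u z.2) * (ψ z.1 * gaussianCutoff n (u z.1)
        - ψ z.2 * gaussianCutoff n (u z.2)) / ‖z.1 - z.2‖ ^ r ≤ E n z - G z := by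
    intro n
    filter_upwards [hu1, hu2] with z h1 h2
    simp only [E, G]
    rw [div_mul_eq_mul_div, ← sub_div]
    gcongr
    exact nonlocal_pointwise_le hp n h1 h2 (hψ0 _) (hψ0 _)
  have hGm : AEStronglyMeasurable G (volume.prod volume) := by
    have hχ : Measurable (indicator {0} 1 : ℝ → ℝ) :=
      measurable_one.indicator (measurableSet_singleton 0)
    have h1 := hum.comp_fst (ν := (volume : Measure (Sp N))) |>.aemeasurable
    have h2 := hum.comp_snd (μ := (volume : Measure (Sp N))) |>.aemeasurable
    refine AEMeasurable.aestronglyMeasurable (AEMeasurable.div (((hχ.comp_aemeasurable h1).mul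
      ?_).mul ?_) ?_)
    · exact (hψ.continuous.comp continuous_fst).measurable.aemeasurable
    · exact (by fun_prop : Measurable fun t : ℝ =>
        |t| ^ (p - 1) * (1 - Real.exp (-t ^ 2))).comp_aemeasurable h2
    · exact Measurable.aemeasurable (by fun_prop)
  have hGi : Integrable G (volume.prod volume) := by
    -- The pointwise inequality at n = 0 itself bounds `G` by a difference of integrable functions.
    refine ((hEi 0).sub (hI 0)).mono' hGm ?_
    filter_upwards [hpt 0] with z hz
    rw [Real.norm_of_nonneg (hG0 z), Pi.sub_apply]
    linarith
  refine ⟨fun n => ∫ z, E n z ∂(volume.prod volume), ?_, ∫ z, G z ∂(volume.prod volume), ?_,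
    fun n => ?_⟩
  · rw [← integral_zero (Sp N × Sp N) ℝ (μ := volume.prod volume)]
    refine tendsto_integral_of_dominated_convergence _ (fun n => (hEi n).1) hE.norm
      (fun n => Eventually.of_forall (hEb n)) ?_
    filter_upwards [hu1, hu2] with z h1 h2
    -- If the maximum is 0, both values vanish and the increment of `u` is 0; otherwise the cutoff
    -- tends to 0.
    rcases eq_or_ne (max (u z.1) (u z.2)) 0 with h | h
    · have e1 : u z.1 = 0 := le_antisymm (h ▸ le_max_left _ _) h1
      have e2 : u z.2 = 0 := le_antisymm (h ▸ le_max_right _ _) h2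
      simp [E, e1, e2]
    · simpa using (gaussianCutoff.tendsto_zero h).const_mul
        (|u z.1 - u z.2| ^ (p - 2) * (u z.1 - u z.2) * (ψ z.1 - ψ z.2) / ‖z.1 - z.2‖ ^ r)
  · rw [gt_iff_lt, integral_pos_iff_support_of_nonneg hG0 hGi]
    have hT : volume {y | 0 < u y} ≠ 0 := by
      intro h0
      refine hne ?_
      have h0' : ∀ᵐ y, ¬ 0 < u y := by
        rw [ae_iff]
        simpa using h0
      filter_upwards [hu0, h0'] with y h1 h2
      exact le_antisymm (not_lt.1 h2) h1
    -- `G` is positive on the product of the zeros of u charged by ψ with {u > 0}; both factors have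
    -- positive measure.
    refine lt_of_lt_of_le ?_ (measure_mono (s := {x | u x = 0 ∧ 0 < ψ x} ×ˢ {y | 0 < u y}) ?_)
    · rw [Measure.prod_prod]
      exact pos_iff_ne_zero.2 (mul_ne_zero hZ hT)
    · rintro ⟨x, y⟩ ⟨⟨hx, hψx⟩, hy⟩
      simp only [mem_ofPred_eq] at hx hψx hy
      have hxy : 0 < ‖x - y‖ := norm_pos_iff.2 (sub_ne_zero.2 fun h => by
        rw [← h, hx] at hy; exact lt_irrefl _ hy)
      have he : 0 < 1 - Real.exp (-u y ^ 2) :=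
        sub_pos.2 (Real.exp_lt_one_iff.2 (neg_neg_of_pos (pow_pos hy 2)))
      have hy' := abs_pos.2 hy.ne'
      rw [Function.mem_support]
      simp only [G, hx, mem_singleton_iff, indicator_of_mem, Pi.one_apply, one_mul]
      positivity
  · rw [← integral_sub (hEi n) hGi]
    have e := integral_prod _ (hI n)
    simp only at e
    rw [← e]
    exact integral_mono_ae (hI n) ((hEi n).sub hGi) (hpt n)

/-! ### The strong maximum principle -/

/-- **Strong maximum principle**: nonnegative eigenfunctions of the mixed operator are positive. -/
lemma IsEigenfunction.pos {s p : ℝ} (hN : 1 ≤ N) (hs0 : 0 < s) (hs1 : s < 1) (hp : 1 < p)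
    {Ω : Set (Sp N)} (hΩ : IsOpen Ω) {V g : Sp N → ℝ} (hV : Integrable V (volume.restrict Ω))
    (hg0 : ∀ᵐ x ∂(volume.restrict Ω), 0 ≤ g x) {lam : ℝ} (hlam : 0 ≤ lam) {u : Sp N → ℝ}
    (hu : IsEigenfunction s p Ω V g lam u) (hu0 : ∀ᵐ x ∂(volume.restrict Ω), 0 ≤ u x) :
    ∀ᵐ x ∂(volume.restrict Ω), 0 < u x := by
  obtain ⟨⟨huX, hsol⟩, hne⟩ := hu
  have hu0' : ∀ᵐ x, 0 ≤ u x := by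
    filter_upwards [(ae_restrict_iff' hΩ.measurableSet).1 hu0, huX.2.2] with x h1 h2
    by_cases h : x ∈ Ω
    · exact h1 h
    · exact (h2 h).ge
  by_contra hcon
  rw [ae_restrict_iff' hΩ.measurableSet, ae_iff] at hcon
  obtain ⟨x, hx, hpos⟩ := exists_mem_forall_mem_nhdsWithin_pos_measure hcon
  simp only [mem_ofPred_eq, Classical.not_imp] at hx
  obtain ⟨ψ, hψ, hψ0, hψx⟩ := exists_isTestFunction_pos hΩ hx.1
  have hZ : volume {x | u x = 0 ∧ 0 < ψ x} ≠ 0 := by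
    refine ((hpos _ (inter_mem_nhdsWithin _ hψx)).trans_le (measure_mono_ae ?_)).ne'
    filter_upwards [hu0'] with y hy hy'
    exact ⟨le_antisymm (not_lt.1 (Classical.not_imp.1 hy'.1).2) hy, hy'.2⟩
  obtain ⟨c, hc, δ, hδ, hnl⟩ := exists_nonlocal_bound hN hs0 hs1 hp hΩ huX hu0' hne hψ hψ0 hZ
  obtain ⟨d, hd, hloc⟩ := exists_local_bound hp hΩ huX hu0 hψ hψ0
  have hpot := tendsto_potential hp huX.2.1.1.1.1 hV hψ
  have key : ∀ n, δ ≤ d n + c n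
      + ∫ x in Ω, V x * |u x| ^ (p - 2) * u x * (ψ x * gaussianCutoff n (u x)) := by
    intro n
    have h := hsol _ (memX_mul_comp hp.le hΩ huX hψ (gaussianCutoff.contDiff n)
      (gaussianCutoff.abs_le_one n) (gaussianCutoff.abs_deriv_le n)).1
    rw [H] at h
    -- Sign of the right-hand side: this term enters the equation with a minus sign and can be
    -- discarded.
    have hgn : 0 ≤ lam * ∫ x in Ω, g x * |u x| ^ (p - 2) * u x *
        (ψ x * gaussianCutoff n (u x)) := by
      refine mul_nonneg hlam (integral_nonneg_of_ae ?_)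
      filter_upwards [hg0, hu0] with x h1 h2
      have := hψ0 x
      have := gaussianCutoff.nonneg n (u x)
      simp only [Pi.zero_apply]
      positivity
    linarith [hnl n, hloc n]
  have := ge_of_tendsto' ((hd.add hc).add hpot) key
  linarith

end MixedEigen

theorem mainTheorem8 (N : ℕ) (hN : 2 ≤ N) (s p q : ℝ) (hs0 : 0 < s) (hs1 : s < 1)
    (hp1 : 1 < p) (hpN : p < N) (hq : (N : ℝ) / (s * p) < q)
    (Ω : Set (EuclideanSpace ℝ (Fin N))) (hΩo : IsOpen Ω) (hΩb : Bornology.IsBounded Ω)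
    (hΩL : MixedEigen.HasLipschitzBoundary Ω)
    (V g : EuclideanSpace ℝ (Fin N) → ℝ)
    (hV : MemLp V (ENNReal.ofReal q) (volume.restrict Ω))
    (hg : MemLp g (ENNReal.ofReal q) (volume.restrict Ω))
    (hV0 : ∀ᵐ x ∂(volume.restrict Ω), 0 ≤ V x)
    (hg0 : ∀ᵐ x ∂(volume.restrict Ω), 0 < g x)
    (lam : ℝ) (hlam : 0 < lam) (u : EuclideanSpace ℝ (Fin N) → ℝ)
    (hu : MixedEigen.IsEigenfunction s p Ω V g lam u)
    (hu0 : ∀ᵐ x ∂(volume.restrict Ω), 0 ≤ u x) :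
    ∀ᵐ x ∂(volume.restrict Ω), 0 < u x := by
  have hp0 : 0 < p := zero_lt_one.trans hp1
  -- From sp < p < N follows q > N/(sp) > 1, so `V` is integrable on the bounded set `Ω`.
  have hq1 : 1 ≤ q := by
    refine le_trans ?_ hq.le
    rw [one_le_div (mul_pos hs0 hp0)]
    nlinarith
  have hfin : IsFiniteMeasure (volume.restrict Ω) := ⟨by simpa using hΩb.measure_lt_top⟩
  exact hu.pos (by omega) hs0 hs1 hp1 hΩo
    (hV.integrable (by simpa using ENNReal.ofReal_le_ofReal hq1))
    (hg0.mono fun _ h => h.le) hlam.le hu0
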